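/- A sequence is a function from an integer interval $I$ (finite or infinite) to $\mathbb{C}$. For a positive integer $n$ and a coefficient tuple $\mathbf{a}^\star = (a_0, a_1, \ldots, a_{\lfloor n/2 \rfloor})$ of complex numbers, let $\mathfrak{S}^\star_n(\mathbf{a}^\star)$ be the class of all sequences $s$ such that \[a_0 s_i s_{i+n} + a_1 s_{i+1} s_{i+n-1} + \cdots + a_{\lfloor n/2 \rfloor} s_{i + \lfloor n/2 \rfloor} s_{i + \lceil n/2 \rceil} = 0\] for all $i$ with $\{i, i+1, \ldots, i+n\} \subseteq I$. A sequence is a Somos sequence of order $n$ if it lies in $\mathfrak{S}^\star_n(\mathbf{a}^\star)$ for some $\mathbf{a}^\star$ with $a_0 \neq 0$, and a Somos sequence of nonstrict order $n$ if it lies in $\mathfrak{S}^\star_n(\mathbf{a}^\star)$ for some $\mathbf{a}^\star \neq (0, \ldots, 0)$. For a positive integer $d$, the decimations of $s$ by a factor of $d$ are the sequences $k \mapsto s_{r + dk}$, with $r \in \mathbb{Z}$, indexed by all $k$ with $r + dk \in I$. Let $s$ be a Somos sequence of order $6$ with nonzero terms. Then every decimation of $s$ is a Somos sequence of nonstrict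 orders both $8$ and $9$. Furthermore, for each positive integer $d$ and each $n \in \{8, 9\}$, there exist coefficients $\mathbf{a}^\star \neq (0, \ldots, 0)$ such that all decimations of $s$ by a factor of $d$ belong to the same class $\mathfrak{S}^\star_n(\mathbf{a}^\star)$. These orders are best possible: let $u$ be the unit Somos sequence of order $6$, i.e., the sequence indexed by $\mathbb{Z}$ with nonzero terms such that $u_0 = u_1 = \cdots = u_5 = 1$ and $u_i u_{i+6} = u_{i+1}u_{i+5} + u_{i+2}u_{i+4} + u_{i+3}^2$ for all $i$. Then $u$ exists and is a Somos sequence of order $6$, and no decimation of $u$ by a factor of $2$ is a Somos sequence of nonstrict order $n$ for any $n$ with $1 \le n \le 7$. -/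

import Mathlib

/-- A sequence of complex numbers indexed by an integer interval `index`, finite or infinite.
Only the values `term i` with `i ∈ index` are terms of the sequence; the values of `term`
elsewhere are never referred to. -/
structure IntervalSeq where
  index : Set ℤ
  ordConnected : index.OrdConnected
  term : ℤ → ℂ

namespace IntervalSeq

/-- All terms are nonzero. -/
def NonzeroTerms (s : IntervalSeq) : Prop :=
  ∀ i ∈ s.index, s.term i ≠ 0

/-- The relation `a₀ sᵢ sᵢ₊ₙ + a₁ sᵢ₊₁ sᵢ₊ₙ₋₁ + ⋯ + a_⌊n/2⌋ sᵢ₊⌊n/2⌋ sᵢ₊⌈n/2⌉ = 0` holds for every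
window `sᵢ, …, sᵢ₊ₙ` of the sequence. -/
def SatisfiesSomos (s : IntervalSeq) (n : ℕ) (a : Fin (n / 2 + 1) → ℂ) : Prop :=
  ∀ i : ℤ, Set.Icc i (i + n) ⊆ s.index →
    ∑ j : Fin (n / 2 + 1), a j * (s.term (i + (j : ℕ)) * s.term (i + n - (j : ℕ))) = 0

/-- Somos sequences of order `n`: the leading coefficient `a₀` is nonzero. -/
def IsSomos (s : IntervalSeq) (n : ℕ) : Prop :=
  ∃ a : Fin (n / 2 + 1) → ℂ, a 0 ≠ 0 ∧ s.SatisfiesSomos n a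

/-- The class of all sequences that satisfy the relation of width `n + 1` with the given
coefficient tuple. -/
def nonstrictClass (n : ℕ) (a : Fin (n / 2 + 1) → ℂ) : Set IntervalSeq :=
  {s | s.SatisfiesSomos n a}

/-- Somos sequences of nonstrict order `n`: the coefficients are not all zero. -/
def IsNonstrictSomos (s : IntervalSeq) (n : ℕ) : Prop :=
  ∃ a : Fin (n / 2 + 1) → ℂ, a ≠ 0 ∧ s ∈ nonstrictClass n a

/-- The decimation `k ↦ s_{r + d k}` of `s` by a factor of `d` (for positive `d`), indexed by all `k`
such that `r + d k` is an index of `s`. As `r` varies, these are all decimations by `d`; residues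
`r` that agree modulo `d` give the same one up to a shift of the index. -/
def decimation (s : IntervalSeq) (d : ℕ) (r : ℤ) : IntervalSeq where
  index := {k | r + d * k ∈ s.index}
  ordConnected := by
    refine ⟨fun x hx y hy z hz => s.ordConnected.out hx hy ⟨?_, ?_⟩⟩
    · have := mul_le_mul_of_nonneg_left hz.1 (Int.natCast_nonneg d)
      linarith
    · have := mul_le_mul_of_nonneg_left hz.2 (Int.natCast_nonneg d)
      linarith
  term k := s.term (r + d * k)

/-- The unit Somos sequence of order `n`: it is indexed by `ℤ`, its terms are nonzero, its terms
with indices `0, …, n - 1` equal `1`, and it satisfies the recurrence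
`sᵢ sᵢ₊ₙ = sᵢ₊₁ sᵢ₊ₙ₋₁ + ⋯ + sᵢ₊⌊n/2⌋ sᵢ₊⌈n/2⌉`. -/
def IsUnitSomos (s : IntervalSeq) (n : ℕ) : Prop :=
  s.index = Set.univ ∧ s.NonzeroTerms ∧
    (∀ i : ℤ, 0 ≤ i → i < n → s.term i = 1) ∧
    ∀ i : ℤ, s.term i * s.term (i + n) =
      ∑ j ∈ Finset.Icc 1 (n / 2), s.term (i + (j : ℕ)) * s.term (i + n - (j : ℕ))

end IntervalSeq

/-! The upper bound is a rank statement: for a Somos sequence of order 6 and fixed `l`, the products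
`s (x + c) * s (x + l - c)`, with rows indexed by `x` and columns by `c`, form a matrix of rank at
most 4. A decimation by `d` with order `n` in `{8, 9}` uses the five columns `c = d * j`, `j ≤ 4`,
of the matrix with `l = d * n`. All its relation vectors therefore lie in one hyperplane of `ℂ⁵`,
whose equation gives coefficients that do not depend on the residue.

The rank bound has two halves. Minors of size 5 on consecutive rows and columns vanish by an
explicit identity built from the recurrence and two first integrals
(`det_shifted_products_eq_zero`). If moreover all consecutive minors of size 4 are nonzero, then
four columns span the rest (`column_mem_span_of_connected_minors`).

A particular sequence may violate this last condition, have `γ = 0`, or be finite. So the parameters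
and initial terms are deformed linearly over `ℂ(t)`, from the given data at `t = 0` to a hyperbolic
cosine sequence at `t = 1` whose 4 × 4 consecutive minors are visibly nonzero
(`det_coshSomos_ne_zero`). The conditions hold for the generic sequence because they hold at `t =
1`; the vanishing of arbitrary 5 × 5 minors then specializes to `t = 0`
(`det_somos_products_eq_zero`).

For optimality, the symmetry `n ↦ 5 - n` of the unit sequence reduces both decimations by 2 to the
even one, where four windows already give a nonsingular system for orders 6 and 7; lower orders
embed into these by padding with zeros. -/

/-! ### Polynomial identities on nine-term windows -/

theorem det_fin_five {R : Type*} [CommRing R]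
    (a b c d e f g h i j k l m n o p q r s t u v w x y : R) :
    Matrix.det !![a, b, c, d, e; f, g, h, i, j; k, l, m, n, o; p, q, r, s, t; u, v, w, x, y] =
    a * (g * (m * (s * y - t * x) - n * (r * y - t * w) + o * (r * x - s * w)) - h * (l * (s * y
      - t * x) - n * (q * y - t * v) + o * (q * x - s * v)) + i * (l * (r * y - t * w) - m * (q * y
      - t * v) + o * (q * w - r * v)) - j * (l * (r * x - s * w) - m * (q * x - s * v) + n * (q * w
      - r * v))) - b * (f * (m * (s * y - t * x) - n * (r * y - t * w) + o * (r * x - s * w)) - h * (k * (s * y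
      - t * x) - n * (p * y - t * u) + o * (p * x - s * u)) + i * (k * (r * y - t * w) - m * (p * y
      - t * u) + o * (p * w - r * u)) - j * (k * (r * x - s * w) - m * (p * x - s * u) + n * (p * w
      - r * u))) + c * (f * (l * (s * y - t * x) - n * (q * y - t * v) + o * (q * x - s * v)) - g * (k * (s * y
      - t * x) - n * (p * y - t * u) + o * (p * x - s * u)) + i * (k * (q * y - t * v) - l * (p * y
      - t * u) + o * (p * v - q * u)) - j * (k * (q * x - s * v) - l * (p * x - s * u) + n * (p * v
      - q * u))) - d * (f * (l * (r * y - t * w) - m * (q * y - t * v) + o * (q * w - r * v)) - g * (k * (r * y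
      - t * w) - m * (p * y - t * u) + o * (p * w - r * u)) + h * (k * (q * y - t * v) - l * (p * y
      - t * u) + o * (p * v - q * u)) - j * (k * (q * w - r * v) - l * (p * w - r * u) + m * (p * v
      - q * u))) + e * (f * (l * (r * x - s * w) - m * (q * x - s * v) + n * (q * w - r * v)) - g * (k * (r * x
      - s * w) - m * (p * x - s * u) + n * (p * w - r * u)) + h * (k * (q * x - s * v) - l * (p * x
      - s * u) + n * (p * v - q * u)) - i * (k * (q * w - r * v) - l * (p * w - r * u) + m * (p * v
      - q * u))) := by
  simp [Matrix.det_succ_row_zero, Fin.sum_univ_succ, Fin.succAbove]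
  ring

/-- The weight is the excess of the index sum of each quartic monomial over 16, the index sum of `s4
^ 4`. This relation and the next two follow from the recurrences and first integrals only after
multiplication by some middle terms, hence the cancellations. The hypotheses are invariant under
`s_i ↦ s_(8-i)`, so reflection also yields weights -1 and -2; weight zero is its own reflection. -/
theorem window_relation_weight_one {F : Type*} [Field F] {α β γ H K s0 s1 s2 s3 s4 s5 s6 s7 s8 : F}
    (z5 : s5 ≠ 0)
    (h0 : s6 * s0 = α * s5 * s1 + β * s4 * s2 + γ * s3 ^ 2)
    (h1 : s7 * s1 = α * s6 * s2 + β * s5 * s3 + γ * s4 ^ 2)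
    (h2 : s8 * s2 = α * s7 * s3 + β * s6 * s4 + γ * s5 ^ 2)
    (hB : s8 * s3 * s1 + s7 * s5 * s0 + γ * s6 * s4 * s2 - α ^ 2 * s6 * s3 ^ 2
      - α ^ 2 * s5 ^ 2 * s2 + H * s5 * s4 * s3 + α * β * s4 ^ 3 = 0)
    (hC : s8 * s4 * s0 + γ * s7 * s3 * s2 + γ * s6 * s5 * s1 + α * β * s6 * s3 ^ 2
      + α * β * s5 ^ 2 * s2 + K * s5 * s4 * s3 - β ^ 2 * s4 ^ 3 = 0) :
    α * s8 * s4^2 * s1 - β * s8 * s3^3 - s7^2 * s3 * s0 + α^2 * s7 * s5 * s3 * s2 - H * s7 * s4 * s3^2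
      + γ * s6^2 * s4 * s1 + α * β * s6 * s5 * s4 * s2 - α * γ * s6 * s5 * s3^2 + K * s6 * s4^2 * s3
      + β * γ * s5 * s4^3 = 0 := by
  apply mul_left_cancel₀ z5
  linear_combination (-s7 * s3) * hB + (s6 * s4) * hC + (-s8 * s4^2) * h0 + (s8 * s3^2) * h1 + (α * s6 * s3^2
      - β * s4^3) * h2

theorem window_relation_weight_zero {F : Type*} [Field F] {α β γ H K s0 s1 s2 s3 s4 s5 s6 s7 s8 : F}
    (z3 : s3 ≠ 0) (z5 : s5 ≠ 0)
    (h0 : s6 * s0 = α * s5 * s1 + β * s4 * s2 + γ * s3 ^ 2)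
    (h1 : s7 * s1 = α * s6 * s2 + β * s5 * s3 + γ * s4 ^ 2)
    (h2 : s8 * s2 = α * s7 * s3 + β * s6 * s4 + γ * s5 ^ 2)
    (hB : s8 * s3 * s1 + s7 * s5 * s0 + γ * s6 * s4 * s2 - α ^ 2 * s6 * s3 ^ 2
      - α ^ 2 * s5 ^ 2 * s2 + H * s5 * s4 * s3 + α * β * s4 ^ 3 = 0)
    (hC : s8 * s4 * s0 + γ * s7 * s3 * s2 + γ * s6 * s5 * s1 + α * β * s6 * s3 ^ 2
      + α * β * s5 ^ 2 * s2 + K * s5 * s4 * s3 - β ^ 2 * s4 ^ 3 = 0) :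
    s8 * s6 * s1^2 + s7^2 * s2 * s0 - α^2 * s7 * s5 * s2^2 + H * s7 * s4 * s3 * s2 + α * β * s7 * s3^3
      - α^2 * s6^2 * s3 * s1 + H * s6 * s5 * s4 * s1 + 2 * α * γ * s6 * s5 * s3 * s2 - α^3 * s6 * s4^2 * s2
      - K * s6 * s4^2 * s2 + β^2 * s6 * s4 * s3^2 + α * β * s5^3 * s1 + β^2 * s5^2 * s4 * s2 + 2 * β * γ * s5^2 * s3^2
      - α^2 * β * s5 * s4^2 * s3 + γ^2 * s5 * s4^2 * s3 - α^2 * γ * s4^4 = 0 := by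
  apply mul_left_cancel₀ (mul_ne_zero z5 z3)
  linear_combination (s7 * s3 * s2 + s6 * s5 * s1) * hB + (-s6 * s4 * s2) * hC + (-s7 * s5^2 * s1
      + α * s7 * s4^2 * s3 + β * s6 * s4^3 + γ * s5^2 * s4^2) * h0 + (-α * s7 * s3^3 - β * s6 * s4 * s3^2
      - α * s5^3 * s1 - β * s5^2 * s4 * s2 - 2 * γ * s5^2 * s3^2 + α^2 * s5 * s4^2 * s3) * h1 + (-s7 * s3^2 * s1
      + s6 * s4^2 * s0) * h2

theorem window_relation_weight_two {F : Type*} [Field F] {α β γ H K s0 s1 s2 s3 s4 s5 s6 s7 s8 : F}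
    (z3 : s3 ≠ 0) (z4 : s4 ≠ 0)
    (h0 : s6 * s0 = α * s5 * s1 + β * s4 * s2 + γ * s3 ^ 2)
    (h1 : s7 * s1 = α * s6 * s2 + β * s5 * s3 + γ * s4 ^ 2)
    (h2 : s8 * s2 = α * s7 * s3 + β * s6 * s4 + γ * s5 ^ 2)
    (hB : s8 * s3 * s1 + s7 * s5 * s0 + γ * s6 * s4 * s2 - α ^ 2 * s6 * s3 ^ 2
      - α ^ 2 * s5 ^ 2 * s2 + H * s5 * s4 * s3 + α * β * s4 ^ 3 = 0)
    (hC : s8 * s4 * s0 + γ * s7 * s3 * s2 + γ * s6 * s5 * s1 + α * β * s6 * s3 ^ 2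
      + α * β * s5 ^ 2 * s2 + K * s5 * s4 * s3 - β ^ 2 * s4 ^ 3 = 0) :
    α * s8 * s5^2 * s0 - γ * s8 * s5 * s4 * s1 + α * s7^2 * s4 * s0 + γ * s7^2 * s2^2 + α * β * s7 * s6 * s3 * s2
      + K * s7 * s5 * s4 * s2 + β * γ * s7 * s4^2 * s3 - α * β * s6^2 * s5 * s1 - α * H * s6 * s5^2 * s2
      + β * γ * s6 * s5^2 * s2 + α * K * s5^3 * s3 - γ * H * s5^2 * s4^2 = 0 := by
  apply mul_left_cancel₀ (mul_ne_zero z4 z3)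
  linear_combination (-α * s6 * s5 * s2 - γ * s5 * s4^2) * hB + (s7 * s4 * s2 + α * s5^2 * s3) * hC
      + (α * s7 * s5^2 * s2 - β * s7 * s4^3) * h0 + (-γ * s6 * s5 * s4 * s2 + α^2 * s6 * s5 * s3^2
      + α^2 * s5^3 * s2 - α * β * s5 * s4^3) * h1 + (-s7 * s4^2 * s0 + α * s6 * s5 * s3 * s1) * h2

/-- The two windows `s` and `t` are linked only by sharing the parameters and the values `H`, `K` of
the first integrals. That suffices, so the windows may lie anywhere along the sequence. -/
theorem det_shifted_products_eq_zero {F : Type*} [Field F] {α β γ H K s0 s1 s2 s3 s4 s5 s6 s7 s8 t0 t1 t2 t3 t4 t5 t6 t7 t8 : F}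
    (hγ : γ ≠ 0)
    (zs3 : s3 ≠ 0) (zs4 : s4 ≠ 0) (zs5 : s5 ≠ 0)
    (hs0 : s6 * s0 = α * s5 * s1 + β * s4 * s2 + γ * s3 ^ 2)
    (hs1 : s7 * s1 = α * s6 * s2 + β * s5 * s3 + γ * s4 ^ 2)
    (hs2 : s8 * s2 = α * s7 * s3 + β * s6 * s4 + γ * s5 ^ 2)
    (hBs : s8 * s3 * s1 + s7 * s5 * s0 + γ * s6 * s4 * s2 - α ^ 2 * s6 * s3 ^ 2
      - α ^ 2 * s5 ^ 2 * s2 + H * s5 * s4 * s3 + α * β * s4 ^ 3 = 0)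
    (hCs : s8 * s4 * s0 + γ * s7 * s3 * s2 + γ * s6 * s5 * s1 + α * β * s6 * s3 ^ 2
      + α * β * s5 ^ 2 * s2 + K * s5 * s4 * s3 - β ^ 2 * s4 ^ 3 = 0)
    (zt3 : t3 ≠ 0) (zt4 : t4 ≠ 0) (zt5 : t5 ≠ 0)
    (ht0 : t6 * t0 = α * t5 * t1 + β * t4 * t2 + γ * t3 ^ 2)
    (ht1 : t7 * t1 = α * t6 * t2 + β * t5 * t3 + γ * t4 ^ 2)
    (ht2 : t8 * t2 = α * t7 * t3 + β * t6 * t4 + γ * t5 ^ 2)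
    (hBt : t8 * t3 * t1 + t7 * t5 * t0 + γ * t6 * t4 * t2 - α ^ 2 * t6 * t3 ^ 2
      - α ^ 2 * t5 ^ 2 * t2 + H * t5 * t4 * t3 + α * β * t4 ^ 3 = 0)
    (hCt : t8 * t4 * t0 + γ * t7 * t3 * t2 + γ * t6 * t5 * t1 + α * β * t6 * t3 ^ 2
      + α * β * t5 ^ 2 * t2 + K * t5 * t4 * t3 - β ^ 2 * t4 ^ 3 = 0) :
    Matrix.det !![t0 * s4, t1 * s3, t2 * s2, t3 * s1, t4 * s0;
      t1 * s5, t2 * s4, t3 * s3, t4 * s2, t5 * s1;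
      t2 * s6, t3 * s5, t4 * s4, t5 * s3, t6 * s2;
      t3 * s7, t4 * s6, t5 * s5, t6 * s4, t7 * s3;
      t4 * s8, t5 * s7, t6 * s6, t7 * s5, t8 * s4] = 0 := by
  have hLs := window_relation_weight_one zs5 hs0 hs1 hs2 hBs hCs
  have hLms := window_relation_weight_one (α := α) (β := β) (γ := γ) (H := H) (K := K)
    (s0 := s8) (s1 := s7) (s2 := s6) (s3 := s5) (s4 := s4) (s5 := s3) (s6 := s2) (s7 := s1) (s8 := s0)
    zs3 (by linear_combination hs2) (by linear_combination hs1)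
    (by linear_combination hs0) (by linear_combination hBs) (by linear_combination hCs)
  have hGs := window_relation_weight_zero zs3 zs5 hs0 hs1 hs2 hBs hCs
  have hMs := window_relation_weight_two zs3 zs4 hs0 hs1 hs2 hBs hCs
  have hMms := window_relation_weight_two (α := α) (β := β) (γ := γ) (H := H) (K := K)
    (s0 := s8) (s1 := s7) (s2 := s6) (s3 := s5) (s4 := s4) (s5 := s3) (s6 := s2) (s7 := s1) (s8 := s0)
    zs5 zs4 (by linear_combination hs2) (by linear_combination hs1)
    (by linear_combination hs0) (by linear_combination hBs) (by linear_combination hCs)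
  have hLt := window_relation_weight_one zt5 ht0 ht1 ht2 hBt hCt
  have hLmt := window_relation_weight_one (α := α) (β := β) (γ := γ) (H := H) (K := K)
    (s0 := t8) (s1 := t7) (s2 := t6) (s3 := t5) (s4 := t4) (s5 := t3) (s6 := t2) (s7 := t1) (s8 := t0)
    zt3 (by linear_combination ht2) (by linear_combination ht1)
    (by linear_combination ht0) (by linear_combination hBt) (by linear_combination hCt)
  have hGt := window_relation_weight_zero zt3 zt5 ht0 ht1 ht2 hBt hCt
  have hMt := window_relation_weight_two zt3 zt4 ht0 ht1 ht2 hBt hCt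
  have hMmt := window_relation_weight_two (α := α) (β := β) (γ := γ) (H := H) (K := K)
    (s0 := t8) (s1 := t7) (s2 := t6) (s3 := t5) (s4 := t4) (s5 := t3) (s6 := t2) (s7 := t1) (s8 := t0)
    zt5 zt4 (by linear_combination ht2) (by linear_combination ht1)
    (by linear_combination ht0) (by linear_combination hBt) (by linear_combination hCt)
  rw [det_fin_five]
  -- The explicit combination of the window relations represents `γ` times the determinant.
  apply mul_left_cancel₀ hγ
  linear_combination (α * s6 * s2 * t7 * t4^2 * t3 * t2 + α * s6 * s2 * t6^2 * t3^2 * t2 + α * s6 * s2 * t6 * t5^2 * t2^2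
        + α * s6 * s2 * t6 * t5 * t4^2 * t1 + γ * s6 * s2 * t6 * t4^2 * t3^2 + γ * s6 * s2 * t5^2 * t4^2 * t2
        + α^2 * s6 * s2 * t5^2 * t4 * t3^2 - γ * s5 * s3 * t7 * t4 * t3^3 - α^2 * s5 * s3 * t6 * t5 * t4 * t3 * t2
        - γ * s5 * s3 * t5^3 * t4 * t1 - α * γ * s5 * s3 * t5 * t4^3 * t3 + γ * s4^2 * t7 * t4^2 * t3 * t2
        + γ * s4^2 * t6 * t5 * t4^2 * t1 + α * γ * s4^2 * t5^2 * t4 * t3^2) * hBs +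
      (α * s7 * s4^2 * s3 * s2 * t6 * t2 + γ * s7 * s4^2 * s3 * s2 * t4^2 - γ * s7 * s4 * s3^3 * t5 * t3
        + α * s6^2 * s3^2 * s2 * t6 * t2 + α * s6 * s5^2 * s2^2 * t6 * t2 + α * s6 * s5 * s4^2 * s1 * t6 * t2
        + γ * s6 * s5 * s4^2 * s1 * t4^2 - α^2 * s6 * s5 * s4 * s3 * s2 * t5 * t3 + γ * s6 * s4^2 * s3^2 * t6 * t2
        - γ * s5^3 * s4 * s1 * t5 * t3 + γ * s5^2 * s4^2 * s2 * t6 * t2 + α^2 * s5^2 * s4 * s3^2 * t6 * t2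
        + α * γ * s5^2 * s4 * s3^2 * t4^2 - α * γ * s5 * s4^3 * s3 * t5 * t3) * hBt +
      (-s6 * s2 * t7 * t5 * t4 * t2^2 - s6 * s2 * t6^2 * t4 * t3 * t1 - α * s6 * s2 * t6 * t5 * t3^3
        - α * s6 * s2 * t6 * t4^3 * t2 - α * s6 * s2 * t5^3 * t3 * t2 + γ * s5 * s3 * t6 * t4^2 * t3^2
        + γ * s5 * s3 * t5^2 * t4^2 * t2 - γ * s4^2 * t6 * t4^3 * t2) * hCs +
      (-s7 * s5 * s4 * s2^2 * t6 * t2 - s6^2 * s4 * s3 * s1 * t6 * t2 - α * s6 * s5 * s3^3 * t6 * t2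
        - α * s6 * s4^3 * s2 * t6 * t2 - γ * s6 * s4^3 * s2 * t4^2 + γ * s6 * s4^2 * s3^2 * t5 * t3
        - α * s5^3 * s3 * s2 * t6 * t2 + γ * s5^2 * s4^2 * s2 * t5 * t3) * hCt +
      (-γ * s3 * t5^2 * t4 * t3^2) * hLs +
      (-γ * s5^2 * s4 * s3^2 * t3) * hLt +
      (-γ * s5 * t5^2 * t4 * t3^2) * hLms +
      (-γ * s5^2 * s4 * s3^2 * t5) * hLmt +
      (-α * s4 * t6 * t5 * t4 * t3 * t2 - γ * s4 * t5 * t4^3 * t3) * hGs +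
      (-α * s6 * s5 * s4 * s3 * s2 * t4 - γ * s5 * s4^3 * s3 * t4) * hGt +
      (s2 * t6 * t5 * t4 * t3 * t2) * hMs +
      (s6 * s5 * s4 * s3 * s2 * t2) * hMt +
      (s6 * t6 * t5 * t4 * t3 * t2) * hMms +
      (s6 * s5 * s4 * s3 * s2 * t6) * hMmt +
      (-α * s8 * s3^2 * t6 * t5 * t4 * t3 * t2 - γ * s8 * s3^2 * t5 * t4^3 * t3 - α * s7 * s5 * s2 * t7 * t4^2 * t3 * t2
        - α * s7 * s5 * s2 * t6^2 * t3^2 * t2 - α * s7 * s5 * s2 * t6 * t5^2 * t2^2 - α * s7 * s5 * s2 * t6 * t5 * t4^2 * t1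
        - α^2 * s7 * s5 * s2 * t5^2 * t4 * t3^2 + α * s7 * s4 * s3 * t7 * t5 * t4 * t2^2 + α * s7 * s4 * s3 * t6^2 * t4 * t3 * t1
        - γ * s7 * s4 * s3 * t6 * t5 * t4 * t3 * t2 + α^2 * s7 * s4 * s3 * t6 * t5 * t3^3 + α^2 * s7 * s4 * s3 * t6 * t4^3 * t2
        + α^2 * s7 * s4 * s3 * t5^3 * t3 * t2 + α * γ * s7 * s4 * s3 * t4^5 - γ * s6^2 * s2 * t6 * t4^3 * t2
        + γ * s6 * s5 * s3 * t7 * t4^2 * t3 * t2 + γ * s6 * s5 * s3 * t6 * t5 * t4^2 * t1 + β * s6 * s4^2 * t7 * t5 * t4 * t2^2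
        + β * s6 * s4^2 * t6^2 * t4 * t3 * t1 + γ * s6 * s4^2 * t6^2 * t4 * t2^2 + α * β * s6 * s4^2 * t6 * t5 * t3^3
        + α * β * s6 * s4^2 * t6 * t4^3 * t2 + α * β * s6 * s4^2 * t5^3 * t3 * t2 + β * γ * s6 * s4^2 * t4^5
        - γ * s5^2 * s4 * t7 * t4^3 * t1 - α * β * s5^2 * s4 * t6 * t5 * t4 * t3 * t2 + α * γ * s5^2 * s4 * t6 * t5 * t3^3
        + α * γ * s5^2 * s4 * t6 * t4^3 * t2 + α * γ * s5^2 * s4 * t5^3 * t3 * t2 - β * γ * s5^2 * s4 * t5 * t4^3 * t3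
        + γ^2 * s5^2 * s4 * t4^5) * hs0 +
      (γ * s7 * s4 * s1 * t5^2 * t4 * t3^2 - γ * s7 * s3 * s2 * t6 * t5 * t3^3 - γ * s7 * s3 * s2 * t5^3 * t3 * t2
        - γ * s6 * s5 * s1 * t6 * t5 * t3^3 - γ * s6 * s5 * s1 * t5^3 * t3 * t2 + γ * s6 * s4 * s2 * t6^2 * t3^2 * t2
        + γ * s6 * s4 * s2 * t6 * t5^2 * t2^2 + α * γ * s6 * s4 * s2 * t5^2 * t4 * t3^2 + γ * s6 * s3^2 * t7 * t5 * t3^2 * t2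
        - α^2 * s6 * s3^2 * t7 * t4^2 * t3 * t2 - α^2 * s6 * s3^2 * t6^2 * t3^2 * t2 + γ * s6 * s3^2 * t6 * t5^2 * t3 * t1
        - α^2 * s6 * s3^2 * t6 * t5^2 * t2^2 - α^2 * s6 * s3^2 * t6 * t5 * t4^2 * t1 - α^3 * s6 * s3^2 * t5^2 * t4 * t3^2
        + γ * s5^2 * s2 * t7 * t5 * t3^2 * t2 - α^2 * s5^2 * s2 * t7 * t4^2 * t3 * t2 - α^2 * s5^2 * s2 * t6^2 * t3^2 * t2
        + γ * s5^2 * s2 * t6 * t5^2 * t3 * t1 - α^2 * s5^2 * s2 * t6 * t5^2 * t2^2 - α^2 * s5^2 * s2 * t6 * t5 * t4^2 * t1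
        - α^3 * s5^2 * s2 * t5^2 * t4 * t3^2 + γ * s5 * s4 * s3 * t8 * t3^4 - 2 * γ * s5 * s4 * s3 * t7 * t5 * t4 * t3 * t1
        + α^2 * s5 * s4 * s3 * t7 * t5 * t4 * t2^2 + α^2 * s5 * s4 * s3 * t6^2 * t4 * t3 * t1 - 2 * α * γ * s5 * s4 * s3 * t6 * t5 * t4 * t3 * t2
        + α^3 * s5 * s4 * s3 * t6 * t5 * t3^3 + α^3 * s5 * s4 * s3 * t6 * t4^3 * t2 + γ * s5 * s4 * s3 * t5^4 * t0
        + α^3 * s5 * s4 * s3 * t5^3 * t3 * t2 + β * γ * s5 * s4 * s3 * t5^2 * t4 * t3^2 + α^2 * γ * s5 * s4 * s3 * t4^5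
        - γ * s4^3 * t8 * t4 * t3^2 * t2 - γ * s4^3 * t6 * t5^2 * t4 * t0 + γ^2 * s4^3 * t5^2 * t4 * t3^2) * hs1
        +
      (s6 * s4 * s0 * t7 * t5 * t4 * t2^2 + s6 * s4 * s0 * t6^2 * t4 * t3 * t1 + α * s6 * s4 * s0 * t6 * t5 * t3^3
        + α * s6 * s4 * s0 * t6 * t4^3 * t2 + α * s6 * s4 * s0 * t5^3 * t3 * t2 + γ * s6 * s4 * s0 * t4^5
        - α * s6 * s3 * s1 * t7 * t4^2 * t3 * t2 - α * s6 * s3 * s1 * t6^2 * t3^2 * t2 - α * s6 * s3 * s1 * t6 * t5^2 * t2^2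
        - α * s6 * s3 * s1 * t6 * t5 * t4^2 * t1 - α^2 * s6 * s3 * s1 * t5^2 * t4 * t3^2 - γ * s6 * s2^2 * t6 * t4^3 * t2
        - α * s5^2 * s0 * t6 * t5 * t4 * t3 * t2 - γ * s5^2 * s0 * t5 * t4^3 * t3 - γ * s5 * s4 * s1 * t6 * t5 * t4 * t3 * t2
        + γ * s5 * s3 * s2 * t7 * t4^2 * t3 * t2 + γ * s5 * s3 * s2 * t6 * t5 * t4^2 * t1 + γ * s4^2 * s2 * t6^2 * t4 * t2^2
        - γ * s4 * s3^2 * t7 * t5 * t4 * t2^2 - γ * s4 * s3^2 * t7 * t4^3 * t1 - γ * s4 * s3^2 * t6^2 * t4 * t3 * t1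
        - α * β * s4 * s3^2 * t6 * t5 * t4 * t3 * t2 - β * γ * s4 * s3^2 * t5 * t4^3 * t3) * hs2
        +
      (α * s7 * s5 * s4 * s2^2 * t7 * t4 * t3 + β * s7 * s5 * s4 * s2^2 * t6 * t4^2 - α * s7 * s4^2 * s3 * s2 * t7 * t5 * t2
        + γ * s7 * s4^2 * s3 * s2 * t6 * t5 * t3 + α * s6^2 * s4 * s3 * s1 * t7 * t4 * t3 + β * s6^2 * s4 * s3 * s1 * t6 * t4^2
        + γ * s6^2 * s4 * s2^2 * t6 * t4^2 - α * s6^2 * s3^2 * s2 * t7 * t5 * t2 - α * s6 * s5^2 * s2^2 * t7 * t5 * t2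
        - α * s6 * s5 * s4^2 * s1 * t7 * t5 * t2 + γ * s6 * s5 * s4^2 * s1 * t6 * t5 * t3 - α * s6 * s5 * s4 * s3 * s2 * t8 * t3^2
        - γ * s6 * s5 * s4 * s3 * s2 * t7 * t4 * t3 - α * β * s6 * s5 * s4 * s3 * s2 * t5^2 * t4
        + α^2 * s6 * s5 * s3^3 * t7 * t4 * t3 + α * β * s6 * s5 * s3^3 * t6 * t4^2 + α * γ * s6 * s5 * s3^3 * t5^2 * t4
        + α^2 * s6 * s4^3 * s2 * t7 * t4 * t3 - γ * s6 * s4^3 * s2 * t6^2 * t2 + α * β * s6 * s4^3 * s2 * t6 * t4^2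
        + α^2 * s5^3 * s3 * s2 * t7 * t4 * t3 + α * β * s5^3 * s3 * s2 * t6 * t4^2 + α * γ * s5^3 * s3 * s2 * t5^2 * t4
        - α^2 * s5^2 * s4 * s3^2 * t7 * t5 * t2 - γ * s5 * s4^3 * s3 * t8 * t3^2 - 2 * β * γ * s5 * s4^3 * s3 * t5^2 * t4
        + α * γ * s4^5 * t7 * t4 * t3 + β * γ * s4^5 * t6 * t4^2) * ht0 +
      (γ * s8 * s3^4 * t5 * t4 * t3 + α^2 * s7 * s5 * s4 * s2^2 * t5 * t4 * t3 + γ * s7 * s5 * s3^2 * s2 * t6 * t3^2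
        + γ * s7 * s5 * s3^2 * s2 * t5^2 * t2 - α^2 * s7 * s4^2 * s3 * s2 * t6 * t3^2 - α^2 * s7 * s4^2 * s3 * s2 * t5^2 * t2
        - α * γ * s7 * s4 * s3^3 * t4^3 + α^2 * s6^2 * s4 * s3 * s1 * t5 * t4 * t3 + γ * s6^2 * s3^2 * s2 * t6 * t4 * t2
        - α^2 * s6^2 * s3^2 * s2 * t6 * t3^2 - α^2 * s6^2 * s3^2 * s2 * t5^2 * t2 + γ * s6 * s5^2 * s3 * s1 * t6 * t3^2
        + γ * s6 * s5^2 * s3 * s1 * t5^2 * t2 + γ * s6 * s5^2 * s2^2 * t6 * t4 * t2 - α^2 * s6 * s5^2 * s2^2 * t6 * t3^2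
        - α^2 * s6 * s5^2 * s2^2 * t5^2 * t2 - α^2 * s6 * s5 * s4^2 * s1 * t6 * t3^2 - α^2 * s6 * s5 * s4^2 * s1 * t5^2 * t2
        - 4 * α * γ * s6 * s5 * s4 * s3 * s2 * t5 * t4 * t3 - γ * s6 * s5 * s3^3 * t7 * t3 * t2 - γ * s6 * s5 * s3^3 * t6 * t5 * t1
        + α^3 * s6 * s5 * s3^3 * t5 * t4 * t3 + α^3 * s6 * s4^3 * s2 * t5 * t4 * t3 - β * γ * s6 * s4^2 * s3^2 * t4^3
        + γ * s5^4 * s0 * t5 * t4 * t3 - α * γ * s5^3 * s4 * s1 * t4^3 - γ * s5^3 * s3 * s2 * t7 * t3 * t2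
        - γ * s5^3 * s3 * s2 * t6 * t5 * t1 + α^3 * s5^3 * s3 * s2 * t5 * t4 * t3 - β * γ * s5^2 * s4^2 * s2 * t4^3
        + γ * s5^2 * s4 * s3^2 * t7 * t4 * t1 + α * γ * s5^2 * s4 * s3^2 * t6 * t4 * t2 - α^3 * s5^2 * s4 * s3^2 * t6 * t3^2
        - α^3 * s5^2 * s4 * s3^2 * t5^2 * t2 - β * γ * s5^2 * s4 * s3^2 * t5 * t4 * t3 - γ^2 * s5^2 * s4 * s3^2 * t4^3
        - 2 * γ^2 * s5 * s4^3 * s3 * t5 * t4 * t3 + α^2 * γ * s4^5 * t5 * t4 * t3) * ht1 +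
      (s7 * s5 * s4 * s2^2 * t6 * t4 * t0 - γ * s7 * s5 * s4 * s2^2 * t4 * t3^2 - α * s7 * s4^2 * s3 * s2 * t6 * t3 * t1
        + γ * s7 * s4^2 * s3 * s2 * t5 * t3 * t2 + s6^2 * s4 * s3 * s1 * t6 * t4 * t0 - γ * s6^2 * s4 * s3 * s1 * t4 * t3^2
        + γ * s6^2 * s4 * s2^2 * t4^2 * t2 - α * s6^2 * s3^2 * s2 * t6 * t3 * t1 - α * s6 * s5^2 * s2^2 * t6 * t3 * t1
        - α * s6 * s5 * s4^2 * s1 * t6 * t3 * t1 + γ * s6 * s5 * s4^2 * s1 * t5 * t3 * t2 - α * s6 * s5 * s4 * s3 * s2 * t5^2 * t0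
        - γ * s6 * s5 * s4 * s3 * s2 * t5 * t4 * t1 - α * β * s6 * s5 * s4 * s3 * s2 * t4 * t3^2
        + α * s6 * s5 * s3^3 * t6 * t4 * t0 + α * s6 * s4^3 * s2 * t6 * t4 * t0 - γ * s6 * s4^3 * s2 * t6 * t2^2
        - α * γ * s6 * s4^3 * s2 * t4 * t3^2 + α * s5^3 * s3 * s2 * t6 * t4 * t0 - α^2 * s5^2 * s4 * s3^2 * t6 * t3 * t1
        - γ * s5 * s4^3 * s3 * t5^2 * t0 - 2 * β * γ * s5 * s4^3 * s3 * t4 * t3^2 + γ * s4^5 * t6 * t4 * t0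
        - γ^2 * s4^5 * t4 * t3^2) * ht2

/-! ### First integrals and vanishing of consecutive 5 × 5 minors -/

/-- The three-parameter Somos relation of order `6` for sequences indexed by all integers. -/
def SatisfiesSomosSix {F : Type*} [Field F] (α β γ : F) (f : ℤ → F) : Prop :=
  ∀ n, f (n + 6) * f n = α * f (n + 5) * f (n + 1) + β * f (n + 4) * f (n + 2) + γ * f (n + 3) ^ 2

theorem exists_forall_eq_of_forall_add_one_eq {X : Type*} {g : ℤ → X} (h : ∀ n, g (n + 1) = g n) :
    ∃ c, ∀ n, g n = c := by
  refine ⟨g 0, fun n => ?_⟩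
  induction n using Int.induction_on with
  | zero => rfl
  | succ i ih => rw [h, ih]
  | pred i ih => rw [← ih, ← h (-(i : ℤ) - 1), sub_add_cancel]

namespace SatisfiesSomosSix

variable {F : Type*} [Field F] {α β γ : F} {f : ℤ → F}

theorem relations (hf : SatisfiesSomosSix α β γ f) (n : ℤ) :
    (f (n + 6) * f n = α * f (n + 5) * f (n + 1) + β * f (n + 4) * f (n + 2) + γ * f (n + 3) ^ 2) ∧
    (f (n + 7) * f (n + 1) =
      α * f (n + 6) * f (n + 2) + β * f (n + 5) * f (n + 3) + γ * f (n + 4) ^ 2) ∧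
    (f (n + 8) * f (n + 2) =
      α * f (n + 7) * f (n + 3) + β * f (n + 6) * f (n + 4) + γ * f (n + 5) ^ 2) ∧
    (f (n + 9) * f (n + 3) =
      α * f (n + 8) * f (n + 4) + β * f (n + 7) * f (n + 5) + γ * f (n + 6) ^ 2) := by
  have h1 := hf (n + 1)
  have h2 := hf (n + 2)
  have h3 := hf (n + 3)
  simp only [add_assoc n] at h1 h2 h3
  norm_num only at h1 h2 h3
  exact ⟨hf n, h1, h2, h3⟩

/-- Both cubic first integrals of a Somos sequence of order `6` are constant along the sequence. -/
theorem exists_first_integrals (hf : SatisfiesSomosSix α β γ f) (h0 : ∀ n, f n ≠ 0) :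
    ∃ H K : F, ∀ n,
      (f (n + 8) * f (n + 3) * f (n + 1) + f (n + 7) * f (n + 5) * f n
        + γ * f (n + 6) * f (n + 4) * f (n + 2) - α ^ 2 * f (n + 6) * f (n + 3) ^ 2
        - α ^ 2 * f (n + 5) ^ 2 * f (n + 2) + H * f (n + 5) * f (n + 4) * f (n + 3)
        + α * β * f (n + 4) ^ 3 = 0) ∧
      (f (n + 8) * f (n + 4) * f n + γ * f (n + 7) * f (n + 3) * f (n + 2)
        + γ * f (n + 6) * f (n + 5) * f (n + 1) + α * β * f (n + 6) * f (n + 3) ^ 2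
        + α * β * f (n + 5) ^ 2 * f (n + 2) + K * f (n + 5) * f (n + 4) * f (n + 3)
        - β ^ 2 * f (n + 4) ^ 3 = 0) := by
  let B : ℤ → F := fun n => f (n + 8) * f (n + 3) * f (n + 1) + f (n + 7) * f (n + 5) * f n
        + γ * f (n + 6) * f (n + 4) * f (n + 2) - α ^ 2 * f (n + 6) * f (n + 3) ^ 2
        - α ^ 2 * f (n + 5) ^ 2 * f (n + 2) + α * β * f (n + 4) ^ 3
  let C : ℤ → F := fun n => f (n + 8) * f (n + 4) * f n + γ * f (n + 7) * f (n + 3) * f (n + 2)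
        + γ * f (n + 6) * f (n + 5) * f (n + 1) + α * β * f (n + 6) * f (n + 3) ^ 2
        + α * β * f (n + 5) ^ 2 * f (n + 2) - β ^ 2 * f (n + 4) ^ 3
  have hshift : ∀ n k : ℤ, f (n + 1 + k) = f (n + (k + 1)) := fun n k => by
    congr 1; ring
  have hB : ∀ n, B (n + 1) / (f (n + 1 + 5) * f (n + 1 + 4) * f (n + 1 + 3)) =
      B n / (f (n + 5) * f (n + 4) * f (n + 3)) := by
    intro n
    obtain ⟨r0, r1, r2, r3⟩ := hf.relations n
    -- Passing from `n` to `n + 1` replaces `f (n + 3)` by `f (n + 6)` in the denominator, so this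
    -- is the invariance of the quotient with denominators cleared. It holds modulo four successive
    -- recurrences.
    have e : f (n + 6) * B n = f (n + 3) * B (n + 1) := by
      simp only [B, hshift]
      norm_num
      linear_combination (f (n + 7) * f (n + 5)) * r0 + (α * f (n + 5) ^ 2) * r1
        + (-α * f (n + 4) ^ 2) * r2 + (-f (n + 4) * f (n + 2)) * r3
    simp only [hshift]
    norm_num
    have := h0 (n + 3); have := h0 (n + 4); have := h0 (n + 5); have := h0 (n + 6)
    field_simp
    linear_combination -e
  have hC : ∀ n, C (n + 1) / (f (n + 1 + 5) * f (n + 1 + 4) * f (n + 1 + 3)) =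
      C n / (f (n + 5) * f (n + 4) * f (n + 3)) := by
    intro n
    obtain ⟨r0, r1, r2, r3⟩ := hf.relations n
    have e : f (n + 6) * C n = f (n + 3) * C (n + 1) := by
      simp only [C, hshift]
      norm_num
      linear_combination (f (n + 8) * f (n + 4)) * r0 + (-β * f (n + 5) ^ 2) * r1
        + (β * f (n + 4) ^ 2) * r2 + (-f (n + 5) * f (n + 1)) * r3
    simp only [hshift]
    norm_num
    have := h0 (n + 3); have := h0 (n + 4); have := h0 (n + 5); have := h0 (n + 6)
    field_simp
    linear_combination -e
  obtain ⟨H, hH⟩ := exists_forall_eq_of_forall_add_one_eq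
    (g := fun n => B n / (f (n + 5) * f (n + 4) * f (n + 3))) hB
  obtain ⟨K, hK⟩ := exists_forall_eq_of_forall_add_one_eq
    (g := fun n => C n / (f (n + 5) * f (n + 4) * f (n + 3))) hC
  refine ⟨-H, -K, fun n => ?_⟩
  have hd : f (n + 5) * f (n + 4) * f (n + 3) ≠ 0 :=
    mul_ne_zero (mul_ne_zero (h0 _) (h0 _)) (h0 _)
  have h1 := (div_eq_iff hd).1 (hH n)
  have h2 := (div_eq_iff hd).1 (hK n)
  constructor
  · linear_combination h1
  · linear_combination h2

theorem det_products_eq_zero (hf : SatisfiesSomosSix α β γ f) (h0 : ∀ n, f n ≠ 0) (hγ : γ ≠ 0)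
    (p q : ℤ) :
    Matrix.det (Matrix.of fun i j : Fin 5 =>
      f (p + (i : ℕ) + (j : ℕ)) * f (q + (i : ℕ) - (j : ℕ))) = 0 := by
  obtain ⟨H, K, hHK⟩ := hf.exists_first_integrals h0
  obtain ⟨s0, s1, s2, -⟩ := hf.relations (q - 4)
  obtain ⟨t0, t1, t2, -⟩ := hf.relations p
  have key := det_shifted_products_eq_zero hγ (h0 _) (h0 _) (h0 _) s0 s1 s2
    (hHK (q - 4)).1 (hHK (q - 4)).2 (h0 _) (h0 _) (h0 _) t0 t1 t2 (hHK p).1 (hHK p).2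
  rw [← key]
  congr 1
  ext i j
  fin_cases i <;> fin_cases j <;> 
    refine congrArg₂ (fun x y => x * y) (congrArg f ?_) (congrArg f ?_) <;> simp <;> ring

end SatisfiesSomosSix

/-! ### Rank from consecutive minors -/

section ConnectedMinors

variable {F : Type*} [Field F] {r : ℕ} {A : ℕ → ℕ → F}

/-- Each singular block has a kernel vector, and the invertible block of size `r` makes it unique
once its last entry is 1. Vertically adjacent blocks share `r` rows, which already determine this
vector, so it is the same for all `x`. -/
theorem exists_column_relation_of_det_eq_zero
    (hzero : ∀ x y, Matrix.det (Matrix.of fun i j : Fin (r + 1) => A (x + i) (y + j)) = 0)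
    (hne : ∀ x y, Matrix.det (Matrix.of fun i j : Fin r => A (x + i) (y + j)) ≠ 0) (y : ℕ) :
    ∃ v : Fin (r + 1) → F, v (Fin.last r) = 1 ∧ ∀ x, ∑ j : Fin (r + 1), A x (y + j) * v j = 0 := by
  have huniq : ∀ (x : ℕ) (w : Fin (r + 1) → F), w (Fin.last r) = 0 →
      (∀ i : Fin r, ∑ j : Fin (r + 1), A (x + i) (y + j) * w j = 0) → w = 0 := by
    intro x w hw h
    have h0 : (fun j : Fin r => w j.castSucc) = 0 := by
      apply Matrix.eq_zero_of_mulVec_eq_zero (hne x y)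
      ext i
      have := h i
      rw [Fin.sum_univ_castSucc, hw, mul_zero, add_zero] at this
      simpa [Matrix.mulVec, dotProduct] using this
    ext j
    refine Fin.lastCases hw (fun j => ?_) j
    exact congrFun h0 j
  have hex : ∀ x, ∃ v : Fin (r + 1) → F, v (Fin.last r) = 1 ∧
      ∀ i : Fin (r + 1), ∑ j : Fin (r + 1), A (x + i) (y + j) * v j = 0 := by
    intro x
    obtain ⟨v, hv, h⟩ := Matrix.exists_mulVec_eq_zero_iff.2 (hzero x y)
    have h' : ∀ i : Fin (r + 1), ∑ j : Fin (r + 1), A (x + i) (y + j) * v j = 0 := fun i => by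
      simpa [Matrix.mulVec, dotProduct] using congrFun h i
    have hl : v (Fin.last r) ≠ 0 := fun hl => hv (huniq x v hl fun i => by
      simpa using h' i.castSucc)
    refine ⟨fun j => v j / v (Fin.last r), div_self hl, fun i => ?_⟩
    simp only [mul_div_assoc', ← Finset.sum_div, h' i, zero_div]
  choose v hv1 hv using hex
  have hstep : ∀ x, v (x + 1) = v x := by
    intro x
    rw [← sub_eq_zero]
    apply huniq (x + 1)
    · simp [hv1]
    · intro i
      have h1 := hv (x + 1) i.castSucc
      have h2 := hv x i.succ
      have e : x + (i.succ : ℕ) = x + 1 + i := by simp; ring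
      rw [e] at h2
      simp only [Pi.sub_apply, mul_sub, Finset.sum_sub_distrib]
      rw [h2, sub_zero]
      simpa using h1
  have hconst : ∀ x, v x = v 0 := fun x => by
    induction x with
    | zero => rfl
    | succ x ih => rw [hstep, ih]
  refine ⟨v 0, hv1 0, fun x => ?_⟩
  have := hv x 0
  rw [hconst x] at this
  simpa using this

/-- If all connected minors of size `r + 1` vanish and all connected minors of size `r` do not,
then the first `r` columns span all columns. -/
theorem column_mem_span_of_connected_minors
    (hzero : ∀ x y, Matrix.det (Matrix.of fun i j : Fin (r + 1) => A (x + i) (y + j)) = 0)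
    (hne : ∀ x y, Matrix.det (Matrix.of fun i j : Fin r => A (x + i) (y + j)) ≠ 0) (y : ℕ) :
    (fun x => A x y) ∈ Submodule.span F (Set.range fun (a : Fin r) (x : ℕ) => A x a) := by
  induction y using Nat.strong_induction_on with
  | _ y ih =>
    by_cases hy : y < r
    · exact Submodule.subset_span ⟨⟨y, hy⟩, rfl⟩
    · obtain ⟨z, rfl⟩ := Nat.exists_eq_add_of_le (not_lt.1 hy)
      obtain ⟨v, hv1, hv⟩ := exists_column_relation_of_det_eq_zero hzero hne z
      have e : (fun x => A x (r + z)) = ∑ j : Fin r, (-v j.castSucc) • fun x => A x (z + j) := by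
        ext x
        have := hv x
        rw [Fin.sum_univ_castSucc, hv1] at this
        simp only [Fin.val_castSucc, Fin.val_last, mul_one] at this
        rw [add_comm r z, ← sub_eq_zero, ← this]
        simp [Finset.sum_apply, mul_comm, add_comm]
      rw [e]
      refine Submodule.sum_mem _ fun j _ => Submodule.smul_mem _ _ (ih _ ?_)
      have := j.2
      omega

theorem det_eq_zero_of_columns_mem_span {X : Type*} {b : Fin r → X → F}
    {V : Fin (r + 1) → X → F} (hV : ∀ j, V j ∈ Submodule.span F (Set.range b))
    (x : Fin (r + 1) → X) : Matrix.det (Matrix.of fun i j : Fin (r + 1) => V j (x i)) = 0 := by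
  have hdep : ¬ LinearIndependent F V := by
    intro hli
    have hli' : LinearIndependent F
        (fun j => (⟨V j, hV j⟩ : Submodule.span F (Set.range b))) :=
      LinearIndependent.of_comp (Submodule.subtype _) hli
    have := Module.Finite.span_of_finite F (Set.finite_range b)
    have h1 := hli'.fintype_card_le_finrank
    have h2 := finrank_range_le_card (R := F) b
    simp only [Fintype.card_fin] at h1 h2
    rw [Set.finrank] at h2
    omega
  rw [Fintype.not_linearIndependent_iff] at hdep
  obtain ⟨g, hg, j, hj⟩ := hdep
  refine Matrix.exists_mulVec_eq_zero_iff.1 ⟨g, fun h => hj (congrFun h j), ?_⟩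
  ext i
  have := congrFun hg (x i)
  simpa [Matrix.mulVec, dotProduct, mul_comm] using this

/-- A family of vectors whose square systems are all singular lies in a hyperplane. -/
theorem exists_ne_zero_forall_sum_eq_zero {ι : Type*} {n : ℕ} (v : ι → Fin n → F)
    (h : ∀ x : Fin n → ι, Matrix.det (Matrix.of fun i => v (x i)) = 0) :
    ∃ a : Fin n → F, a ≠ 0 ∧ ∀ i, ∑ j, a j * v i j = 0 := by
  by_cases htop : Submodule.span F (Set.range v) = ⊤
  · exfalso
    -- If the family spanned everything, a basis chosen among its members would be the rows of an
    -- invertible square matrix.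
    obtain ⟨s, hs, hspan, hli⟩ := exists_linearIndependent F (Set.range v)
    rw [htop] at hspan
    let b := Module.Basis.mk hli (by rw [Subtype.range_coe, hspan])
    have hc := Module.finrank_eq_nat_card_basis b
    have : Finite s := Module.Finite.finite_basis b
    have hfin : Nat.card s = n := by rw [← hc]; simp
    let e : Fin n ≃ s := (Finite.equivFinOfCardEq hfin).symm
    choose x hx using fun i : Fin n => hs (e i).2
    have hli' : LinearIndependent F (fun i => v (x i)) := by
      rw [show (fun i => v (x i)) = Subtype.val ∘ e from funext hx]
      exact hli.comp e e.injective
    have hu := Matrix.linearIndependent_rows_iff_isUnit.1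
      (show LinearIndependent F (Matrix.of fun i => v (x i)).row from hli')
    rw [Matrix.isUnit_iff_isUnit_det, h x] at hu
    exact not_isUnit_zero hu
  · obtain ⟨φ, hφ, hle⟩ := Submodule.exists_le_ker_of_lt_top _ (lt_top_iff_ne_top.2 htop)
    refine ⟨fun j => φ (Pi.single j 1), fun h0 => hφ ?_, fun i => ?_⟩
    · refine LinearMap.pi_ext' fun j => LinearMap.ext_ring ?_
      simpa using congrFun h0 j
    · have h1 : φ (v i) = 0 := hle (Submodule.subset_span ⟨i, rfl⟩)
      have e : ∀ j : Fin n, (fun k => if j = k then (1 : F) else 0) = Pi.single j 1 := fun j => by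
        ext k
        simp [Pi.single_apply, eq_comm]
      rw [LinearMap.pi_apply_eq_sum_univ] at h1
      simp only [e, smul_eq_mul] at h1
      simpa only [mul_comm] using h1

end ConnectedMinors

/-! ### Two-sided sequences from six initial terms -/

section TwoSided

variable {F : Type*} [Field F]

/-- The one-sided Somos sequence of order `6` with initial terms `x 0, …, x 5`. -/
def somosForward (α β γ : F) (x : ℕ → F) : ℕ → F
  | 0 => x 0
  | 1 => x 1
  | 2 => x 2
  | 3 => x 3
  | 4 => x 4
  | 5 => x 5
  | n + 6 => (α * somosForward α β γ x (n + 5) * somosForward α β γ x (n + 1)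
      + β * somosForward α β γ x (n + 4) * somosForward α β γ x (n + 2)
      + γ * somosForward α β γ x (n + 3) ^ 2) / somosForward α β γ x n

theorem somosForward_of_lt (α β γ : F) (x : ℕ → F) {n : ℕ} (hn : n < 6) :
    somosForward α β γ x n = x n := by
  interval_cases n <;> simp [somosForward]

/-- The two-sided Somos sequence of order `6` with initial terms `x 0, …, x 5`. -/
def somosTwoSided (α β γ : F) (x : ℕ → F) (n : ℤ) : F :=
  if 0 ≤ n then somosForward α β γ x n.toNat
  else somosForward α β γ (fun i => x (5 - i)) (5 - n).toNat

theorem somosTwoSided_natCast (α β γ : F) (x : ℕ → F) (n : ℕ) :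
    somosTwoSided α β γ x n = somosForward α β γ x n := by
  simp [somosTwoSided]

theorem somosTwoSided_five_sub (α β γ : F) (x : ℕ → F) (n : ℕ) :
    somosTwoSided α β γ x (5 - n) = somosForward α β γ (fun i => x (5 - i)) n := by
  unfold somosTwoSided
  split_ifs with h
  · have h6 : n < 6 := by omega
    have e : ((5 : ℤ) - n).toNat = 5 - n := by omega
    rw [e, somosForward_of_lt _ _ _ _ h6, somosForward_of_lt _ _ _ _ (by omega)]
  · congr 1
    omega

theorem satisfiesSomosSix_somosTwoSided (α β γ : F) (x : ℕ → F)
    (h0 : ∀ n, somosTwoSided α β γ x n ≠ 0) :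
    SatisfiesSomosSix α β γ (somosTwoSided α β γ x) := by
  intro n
  rcases le_or_gt 0 n with hn | hn
  · obtain ⟨m, rfl⟩ := Int.eq_ofNat_of_zero_le hn
    have h := h0 m
    have e : ∀ k : ℕ, somosTwoSided α β γ x ((m : ℤ) + k) = somosForward α β γ x (m + k) :=
      fun k => by rw [← somosTwoSided_natCast]; push_cast; rfl
    have e1 := e 1; have e2 := e 2; have e3 := e 3
    have e4 := e 4; have e5 := e 5; have e6 := e 6
    push_cast at e1 e2 e3 e4 e5 e6
    rw [e1, e2, e3, e4, e5, e6]
    rw [somosTwoSided_natCast] at h ⊢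
    rw [somosForward]
    field_simp
  -- For `n < 0` all of `n, …, n + 6` are at most 5, so the whole window lies in the reversed
  -- forward sequence, and the recurrence is symmetric under reversal.
  · obtain ⟨m, hm⟩ := Int.eq_ofNat_of_zero_le (show 0 ≤ -n - 1 by omega)
    have e : ∀ k : ℕ, somosTwoSided α β γ x (5 - ((m + k : ℕ) : ℤ)) =
        somosForward α β γ (fun i => x (5 - i)) (m + k) :=
      fun k => somosTwoSided_five_sub α β γ x _
    have hk : ∀ k : ℕ, k ≤ 6 → n + ((6 - k : ℕ) : ℤ) = 5 - ((m + k : ℕ) : ℤ) := fun k hk => by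
      omega
    have h := h0 (n + 6)
    have k0 := hk 0 (by norm_num); have k1 := hk 1 (by norm_num); have k2 := hk 2 (by norm_num)
    have k3 := hk 3 (by norm_num); have k4 := hk 4 (by norm_num); have k5 := hk 5 (by norm_num)
    have k6 := hk 6 (by norm_num)
    norm_num only [Nat.cast_ofNat, Nat.cast_one, Nat.cast_zero, add_zero] at k0 k1 k2 k3 k4 k5 k6
    rw [k0] at h ⊢
    rw [k1, k2, k3, k4, k5]
    rw [show somosTwoSided α β γ x n = somosTwoSided α β γ x (5 - ((m + 6 : ℕ) : ℤ)) from
      congrArg _ k6]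
    have e0 := e 0
    rw [add_zero] at e0
    rw [e0] at h ⊢
    rw [e 1, e 2, e 3, e 4, e 5, e 6]
    rw [somosForward]
    field_simp

end TwoSided

/-! ### Specialization of rational functions -/

section HasValue

open Polynomial

variable {k : Type*} [Field k] {a : k} {f g : RatFunc k} {v w : k}

/-- The rational function `f` is defined at `a` and has the value `v` there. -/
def HasValue (a : k) (f : RatFunc k) (v : k) : Prop :=
  ∃ p q : k[X], q.eval a ≠ 0 ∧ f * algebraMap k[X] (RatFunc k) q = algebraMap k[X] (RatFunc k) p ∧
    p.eval a = v * q.eval a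

namespace HasValue

theorem algebraMap (a : k) (p : k[X]) : HasValue a (algebraMap k[X] (RatFunc k) p) (p.eval a) :=
  ⟨p, 1, by simp, by simp, by simp⟩

theorem intCast (a : k) (n : ℤ) : HasValue a (n : RatFunc k) n := by
  simpa using HasValue.algebraMap a (n : k[X])

theorem add (hf : HasValue a f v) (hg : HasValue a g w) : HasValue a (f + g) (v + w) := by
  obtain ⟨p, q, hq, h, hv⟩ := hf
  obtain ⟨p', q', hq', h', hw⟩ := hg
  refine ⟨p * q' + p' * q, q * q', by simp [hq, hq'], ?_, ?_⟩
  · simp only [map_mul, map_add, ← h, ← h']; ring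
  · simp only [eval_mul, eval_add, hv, hw]; ring

theorem mul (hf : HasValue a f v) (hg : HasValue a g w) : HasValue a (f * g) (v * w) := by
  obtain ⟨p, q, hq, h, hv⟩ := hf
  obtain ⟨p', q', hq', h', hw⟩ := hg
  refine ⟨p * p', q * q', by simp [hq, hq'], ?_, ?_⟩
  · simp only [map_mul, ← h, ← h']; ring
  · simp only [eval_mul, hv, hw]; ring

theorem ne_zero (hf : HasValue a f v) (hv : v ≠ 0) : f ≠ 0 := by
  rintro rfl
  obtain ⟨p, q, hq, h, h'⟩ := hf
  rw [zero_mul, eq_comm, map_eq_zero_iff _ (RatFunc.algebraMap_injective k)] at h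
  rw [h, eval_zero, eq_comm] at h'
  exact mul_ne_zero hv hq h'

theorem inv (hf : HasValue a f v) (hv : v ≠ 0) : HasValue a f⁻¹ v⁻¹ := by
  have hf0 := hf.ne_zero hv
  obtain ⟨p, q, hq, h, h'⟩ := hf
  refine ⟨q, p, by rw [h']; exact mul_ne_zero hv hq, ?_, ?_⟩
  · rw [← h]; field_simp
  · rw [h']; field_simp

theorem div (hf : HasValue a f v) (hg : HasValue a g w) (hw : w ≠ 0) :
    HasValue a (f / g) (v / w) := by
  rw [div_eq_mul_inv, div_eq_mul_inv]
  exact hf.mul (hg.inv hw)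

theorem pow (hf : HasValue a f v) (n : ℕ) : HasValue a (f ^ n) (v ^ n) := by
  induction n with
  | zero => simpa using HasValue.intCast a 1
  | succ n ih => rw [pow_succ, pow_succ]; exact ih.mul hf

theorem sum {ι : Type*} {s : Finset ι} {f : ι → RatFunc k} {v : ι → k}
    (h : ∀ i ∈ s, HasValue a (f i) (v i)) : HasValue a (∑ i ∈ s, f i) (∑ i ∈ s, v i) := by
  classical
  induction s using Finset.induction_on with
  | empty => simpa using HasValue.intCast a 0
  | insert i s hi ih =>
    rw [Finset.sum_insert hi, Finset.sum_insert hi]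
    exact (h i (by simp)).add (ih fun j hj => h j (by simp [hj]))

theorem prod {ι : Type*} {s : Finset ι} {f : ι → RatFunc k} {v : ι → k}
    (h : ∀ i ∈ s, HasValue a (f i) (v i)) : HasValue a (∏ i ∈ s, f i) (∏ i ∈ s, v i) := by
  classical
  induction s using Finset.induction_on with
  | empty => simpa using HasValue.intCast a 1
  | insert i s hi ih =>
    rw [Finset.prod_insert hi, Finset.prod_insert hi]
    exact (h i (by simp)).mul (ih fun j hj => h j (by simp [hj]))

theorem det {n : ℕ} {M : Matrix (Fin n) (Fin n) (RatFunc k)} {N : Matrix (Fin n) (Fin n) k}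
    (h : ∀ i j, HasValue a (M i j) (N i j)) : HasValue a M.det N.det := by
  rw [Matrix.det_apply', Matrix.det_apply']
  exact HasValue.sum fun σ _ => (HasValue.intCast a _).mul (HasValue.prod fun i _ => h _ _)

/-- Each recursive step divides by a term with nonzero value, so specialization commutes with it.
The bound `N` lets the specialized sequence be finite. -/
theorem somosForward {α β γ : RatFunc k} {α' β' γ' : k} {x : ℕ → RatFunc k} {y : ℕ → k} {N : ℕ}
    (hα : HasValue a α α') (hβ : HasValue a β β') (hγ : HasValue a γ γ')
    (hx : ∀ n < 6, HasValue a (x n) (y n)) (hy : ∀ n ≤ N, y n ≠ 0)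
    (hrec : ∀ n, n + 6 ≤ N → y (n + 6) * y n =
      α' * y (n + 5) * y (n + 1) + β' * y (n + 4) * y (n + 2) + γ' * y (n + 3) ^ 2) :
    ∀ n ≤ N, HasValue a (somosForward α β γ x n) (y n) := by
  intro n
  induction n using Nat.strong_induction_on with
  | _ n ih =>
    intro hn
    by_cases h6 : n < 6
    · rw [somosForward_of_lt _ _ _ _ h6]
      exact hx n h6
    · obtain ⟨m, rfl⟩ := Nat.exists_eq_add_of_le' (not_lt.1 h6)
      rw [_root_.somosForward, eq_div_of_mul_eq (hy m (by omega)) (hrec m hn)]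
      refine HasValue.div (((HasValue.mul (hα.mul ?_) ?_).add (HasValue.mul (hβ.mul ?_) ?_)).add
        (hγ.mul (HasValue.pow ?_ _))) ?_ (hy m (by omega)) <;>
      exact ih _ (by omega) (by omega)

end HasValue

end HasValue

/-! ### A reference sequence with nonzero consecutive 4 × 4 minors -/

section CoshSequence

/-- Twice the hyperbolic cosine of `n * log 2`. -/
noncomputable def twoCosh (n : ℤ) : ℝ := 2 ^ n + 2 ^ (-n)

theorem twoCosh_pos (n : ℤ) : 0 < twoCosh n := by
  unfold twoCosh; positivity

theorem twoCosh_lt {i j : ℤ} (hi : 0 ≤ i) (hij : i < j) : twoCosh i < twoCosh j := by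
  have h1 : (1 : ℝ) ≤ 2 ^ i := one_le_zpow₀ (by norm_num) hi
  have h2 : (2 : ℝ) ^ i < 2 ^ j := zpow_lt_zpow_right₀ (by norm_num) hij
  unfold twoCosh
  rw [zpow_neg, zpow_neg]
  set u := (2 : ℝ) ^ i
  set v := (2 : ℝ) ^ j
  have hu : 0 < u := by linarith
  have hv : 0 < v := by linarith
  have e : v + v⁻¹ - (u + u⁻¹) = (v - u) * (u * v - 1) / (u * v) := by
    field_simp; ring
  have h3 : 1 < u * v := by nlinarith
  have : 0 < (v - u) * (u * v - 1) / (u * v) :=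
    div_pos (mul_pos (by linarith) (by linarith)) (by positivity)
  linarith

/-- A Somos sequence of order `6` whose products `f (m + k) f (m - k)` are biquadratic forms in
hyperbolic cosines. -/
noncomputable def coshSomos (q : ℝ) (n : ℤ) : ℝ := twoCosh (4 * n) + q * twoCosh (2 * n)

theorem coshSomos_pos {q : ℝ} (hq : 0 < q) (n : ℤ) : 0 < coshSomos q n :=
  add_pos (twoCosh_pos _) (mul_pos hq (twoCosh_pos _))

/-- Product-to-sum formulas turn the product into an expression in the sum and difference of the
indices alone, so row and column variables of the product matrix separate. -/
theorem coshSomos_mul (q : ℝ) (a b : ℤ) :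
    coshSomos q a * coshSomos q b =
      twoCosh (a + b) ^ 4 + twoCosh (a - b) ^ 4
        + (q ^ 2 - 4) * (twoCosh (a + b) ^ 2 + twoCosh (a - b) ^ 2) + 4 - 4 * q ^ 2
        + q * (twoCosh (a + b) ^ 3 * twoCosh (a - b) + twoCosh (a + b) * twoCosh (a - b) ^ 3
          - 6 * twoCosh (a + b) * twoCosh (a - b)) := by
  have h2 : (2 : ℝ) ≠ 0 := by norm_num
  have e : ∀ k n : ℤ, (2 : ℝ) ^ (k * n) = (2 ^ n) ^ k := fun k n => by rw [mul_comm, zpow_mul]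
  unfold coshSomos twoCosh
  simp only [zpow_neg, zpow_add₀ h2, zpow_sub₀ h2, e]
  have hx : (2 : ℝ) ^ a ≠ 0 := by positivity
  have hy : (2 : ℝ) ^ b ≠ 0 := by positivity
  set x := (2 : ℝ) ^ a
  set y := (2 : ℝ) ^ b
  norm_cast
  field_simp
  ring

/-- The index differences 6, 4, 2, 0 give four values `z` of `twoCosh`. The value of `q ^ 2` is the
one for which the second elementary symmetric function of these values equals `q ^ 2 - 4`, which
makes the last factor in `det_biquadratic` vanish. The three parameters are the coefficients of the
resulting dependency. -/
theorem coshSomos_relation {q : ℝ} (hq : q ^ 2 = 1578229 / 1024) (n : ℤ) :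
    coshSomos q (n + 6) * coshSomos q n =
      4497 / 64 * coshSomos q (n + 5) * coshSomos q (n + 1)
        + -105369 / 256 * coshSomos q (n + 4) * coshSomos q (n + 2)
        + 87637 / 256 * coshSomos q (n + 3) ^ 2 := by
  have c0 : twoCosh 0 = 2 := by norm_num [twoCosh]
  have c2 : twoCosh 2 = 17 / 4 := by norm_num [twoCosh]
  have c4 : twoCosh 4 = 257 / 16 := by norm_num [twoCosh]
  have c6 : twoCosh 6 = 4097 / 64 := by norm_num [twoCosh]
  have e : ∀ i j : ℤ, i + j = 6 → coshSomos q (n + i) * coshSomos q (n + j) =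
      twoCosh (2 * n + 6) ^ 4 + twoCosh (i - j) ^ 4
        + (q ^ 2 - 4) * (twoCosh (2 * n + 6) ^ 2 + twoCosh (i - j) ^ 2) + 4 - 4 * q ^ 2
        + q * (twoCosh (2 * n + 6) ^ 3 * twoCosh (i - j)
          + twoCosh (2 * n + 6) * twoCosh (i - j) ^ 3
          - 6 * twoCosh (2 * n + 6) * twoCosh (i - j)) := fun i j hij => by
    rw [coshSomos_mul, show n + i + (n + j) = 2 * n + 6 by linarith,
      show n + i - (n + j) = i - j by ring]
  have e0 := e 6 0 (by norm_num)
  have e1 := e 5 1 (by norm_num)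
  have e2 := e 4 2 (by norm_num)
  have e3 := e 3 3 (by norm_num)
  norm_num only [add_zero, hq, c0, c2, c4, c6, sub_self] at e0 e1 e2 e3
  set w := twoCosh (2 * n + 6)
  linear_combination e0 - 4497 / 64 * e1 + 105369 / 256 * e2 - 87637 / 256 * e3

theorem det_biquadratic {R : Type*} [CommRing R] (q : R) (w z : Fin 4 → R) :
    Matrix.det (Matrix.of fun i j : Fin 4 => w i ^ 4 + z j ^ 4
        + (q ^ 2 - 4) * (w i ^ 2 + z j ^ 2) + 4 - 4 * q ^ 2
        + q * (w i ^ 3 * z j + w i * z j ^ 3 - 6 * w i * z j)) =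
      q ^ 2 * ((w 1 - w 0) * (w 2 - w 0) * (w 3 - w 0) * (w 2 - w 1) * (w 3 - w 1) * (w 3 - w 2)
        * (w 0 * w 1 + w 0 * w 2 + w 0 * w 3 + w 1 * w 2 + w 1 * w 3 + w 2 * w 3 - (q ^ 2 - 4)))
      * ((z 1 - z 0) * (z 2 - z 0) * (z 3 - z 0) * (z 2 - z 1) * (z 3 - z 1) * (z 3 - z 2)
        * (z 0 * z 1 + z 0 * z 2 + z 0 * z 3 + z 1 * z 2 + z 1 * z 3 + z 2 * z 3 - (q ^ 2 - 4))) := by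
  -- For `x i = twoCosh m` the last two entries are `twoCosh (3 * m)` and `twoCosh (4 * m) + q ^ 2 *
  -- twoCosh (2 * m)`. In these four functions the form is bilinear with antidiagonal matrix `J`.
  let G : (Fin 4 → R) → Matrix (Fin 4) (Fin 4) R := fun x => Matrix.of fun i =>
    ![1, x i, x i ^ 3 - 3 * x i, x i ^ 4 + (q ^ 2 - 4) * x i ^ 2 + 2 - 2 * q ^ 2]
  have hG : ∀ x, (G x).det =
      (x 1 - x 0) * (x 2 - x 0) * (x 3 - x 0) * (x 2 - x 1) * (x 3 - x 1) * (x 3 - x 2)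
      * (x 0 * x 1 + x 0 * x 2 + x 0 * x 3 + x 1 * x 2 + x 1 * x 3 + x 2 * x 3 - (q ^ 2 - 4)) := by
    intro x
    simp [G, Matrix.det_succ_row_zero, Fin.sum_univ_succ, Fin.succAbove]
    ring
  let J : Matrix (Fin 4) (Fin 4) R := !![0, 0, 0, 1; 0, 0, q, 0; 0, q, 0, 0; 1, 0, 0, 0]
  have hJ : J.det = q ^ 2 := by
    simp [J, Matrix.det_succ_row_zero, Fin.sum_univ_succ, Fin.succAbove]
    ring
  have hM : (Matrix.of fun i j : Fin 4 => w i ^ 4 + z j ^ 4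
        + (q ^ 2 - 4) * (w i ^ 2 + z j ^ 2) + 4 - 4 * q ^ 2
        + q * (w i ^ 3 * z j + w i * z j ^ 3 - 6 * w i * z j)) = G w * J * (G z).transpose := by
    ext i j
    simp [G, J, Matrix.mul_apply, Fin.sum_univ_succ]
    ring
  rw [hM, Matrix.det_mul, Matrix.det_mul, Matrix.det_transpose, hG, hG, hJ]
  ring

/-- At `p = 0` the last factor would be exactly zero by the choice of `q`. Since `twoCosh` increases
strictly on nonnegative integers, the factor is positive for every `p > 0`. -/
theorem vandermonde_mul_ne_zero {q : ℝ} (hq : q ^ 2 = 1578229 / 1024) {p : ℤ} (hp : 0 < p)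
    {w : Fin 4 → ℝ} (hw : ∀ i : Fin 4, w i = twoCosh (p + 2 * (i : ℕ))) :
    (w 1 - w 0) * (w 2 - w 0) * (w 3 - w 0) * (w 2 - w 1) * (w 3 - w 1) * (w 3 - w 2)
        * (w 0 * w 1 + w 0 * w 2 + w 0 * w 3 + w 1 * w 2 + w 1 * w 3 + w 2 * w 3 - (q ^ 2 - 4))
      ≠ 0 := by
  have hlt : ∀ i j : Fin 4, i < j → w j - w i ≠ 0 := fun i j hij => by
    rw [hw, hw]
    refine (sub_pos.2 (twoCosh_lt (by positivity) ?_)).ne'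
    have : (i : ℕ) < j := hij
    omega
  have c0 : twoCosh 0 = 2 := by norm_num [twoCosh]
  have c2 : twoCosh 2 = 17 / 4 := by norm_num [twoCosh]
  have c4 : twoCosh 4 = 257 / 16 := by norm_num [twoCosh]
  have c6 : twoCosh 6 = 4097 / 64 := by norm_num [twoCosh]
  have h0 : 2 < w 0 := by rw [hw, ← c0]; exact twoCosh_lt (by norm_num) (by simpa using hp)
  have h1 : 17 / 4 < w 1 := by rw [hw, ← c2]; exact twoCosh_lt (by norm_num) (by simpa using hp)
  have h2 : 257 / 16 < w 2 := by rw [hw, ← c4]; exact twoCosh_lt (by norm_num) (by simpa using hp)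
  have h3 : 4097 / 64 < w 3 := by rw [hw, ← c6]; exact twoCosh_lt (by norm_num) (by simpa using hp)
  have hm : ∀ {a b x y : ℝ}, 0 ≤ a → 0 ≤ b → a < x → b < y → a * b < x * y := fun ha hb hx hy =>
    mul_lt_mul'' hx hy ha hb
  have m01 := hm (by norm_num) (by norm_num) h0 h1
  have m02 := hm (by norm_num) (by norm_num) h0 h2
  have m03 := hm (by norm_num) (by norm_num) h0 h3
  have m12 := hm (by norm_num) (by norm_num) h1 h2
  have m13 := hm (by norm_num) (by norm_num) h1 h3
  have m23 := hm (by norm_num) (by norm_num) h2 h3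
  refine mul_ne_zero (mul_ne_zero (mul_ne_zero (mul_ne_zero (mul_ne_zero (mul_ne_zero
    (hlt 0 1 (by decide)) (hlt 0 2 (by decide))) (hlt 0 3 (by decide))) (hlt 1 2 (by decide)))
    (hlt 1 3 (by decide))) (hlt 2 3 (by decide))) (ne_of_gt ?_)
  rw [hq]
  norm_num at m01 m02 m03 m12 m13 m23 ⊢
  linarith

theorem det_coshSomos_ne_zero {q : ℝ} (hq : q ^ 2 = 1578229 / 1024) {δ : ℤ} (hδ : 0 < δ)
    (x y : ℕ) :
    Matrix.det (Matrix.of fun i j : Fin 4 =>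
      coshSomos q ((x + i : ℕ) + (y + j : ℕ) + δ) * coshSomos q ((x + i : ℕ) - (y + j : ℕ))) ≠ 0 := by
  have e := det_biquadratic q (fun i : Fin 4 => twoCosh (2 * x + δ + 2 * (i : ℕ)))
    (fun j : Fin 4 => twoCosh (2 * y + δ + 2 * (j : ℕ)))
  have h : ∀ i j : Fin 4, coshSomos q ((x + i : ℕ) + (y + j : ℕ) + δ) *
      coshSomos q ((x + i : ℕ) - (y + j : ℕ)) = _ := fun i j => by
    rw [coshSomos_mul, show ((x + i : ℕ) + (y + j : ℕ) + δ + ((x + i : ℕ) - (y + j : ℕ)) : ℤ) =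
      2 * x + δ + 2 * (i : ℕ) by push_cast; ring,
      show ((x + i : ℕ) + (y + j : ℕ) + δ - ((x + i : ℕ) - (y + j : ℕ)) : ℤ) =
      2 * y + δ + 2 * (j : ℕ) by push_cast; ring]
  simp only [h]
  rw [e]
  refine mul_ne_zero (mul_ne_zero (by rw [hq]; norm_num) ?_) ?_
  · exact vandermonde_mul_ne_zero hq (p := 2 * x + δ) (by positivity) fun i => rfl
  · exact vandermonde_mul_ne_zero hq (p := 2 * y + δ) (by positivity) fun i => rfl

end CoshSequence

/-! ### Deformation and the rank bound -/

section Rank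

open Polynomial

/-- The rational function interpolating linearly between `u` at `0` and `v` at `1`. -/
noncomputable def lineBetween (u v : ℂ) : RatFunc ℂ :=
  algebraMap ℂ[X] (RatFunc ℂ) (C u + X * (C v - C u))

theorem hasValue_zero_lineBetween (u v : ℂ) : HasValue 0 (lineBetween u v) u := by
  have h := HasValue.algebraMap (0 : ℂ) (C u + X * (C v - C u))
  rwa [show eval 0 (C u + X * (C v - C u)) = u by simp] at h

theorem hasValue_one_lineBetween (u v : ℂ) : HasValue 1 (lineBetween u v) v := by
  have h := HasValue.algebraMap (1 : ℂ) (C u + X * (C v - C u))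
  rwa [show eval 1 (C u + X * (C v - C u)) = v by simp] at h

theorem HasValue.somosTwoSided {k : Type*} [Field k] {a : k} {α β γ : RatFunc k} {α' β' γ' : k}
    {x : ℕ → RatFunc k} {y : ℤ → k}
    (hα : HasValue a α α') (hβ : HasValue a β β') (hγ : HasValue a γ γ')
    (hx : ∀ n : ℕ, n < 6 → HasValue a (x n) (y n)) (hy : ∀ n, y n ≠ 0)
    (hrec : SatisfiesSomosSix α' β' γ' y) (n : ℤ) :
    HasValue a (somosTwoSided α β γ x n) (y n) := by
  rcases le_or_gt 0 n with hn | hn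
  · obtain ⟨m, rfl⟩ := Int.eq_ofNat_of_zero_le hn
    rw [somosTwoSided_natCast]
    refine HasValue.somosForward (y := fun m : ℕ => y m) hα hβ hγ hx (fun _ _ => hy _)
      (fun i _ => ?_) m le_rfl
    simpa using hrec i
  · obtain ⟨m, hm⟩ := Int.eq_ofNat_of_zero_le (show 0 ≤ 5 - n by omega)
    obtain rfl : n = 5 - m := by omega
    rw [somosTwoSided_five_sub]
    refine HasValue.somosForward (y := fun m : ℕ => y (5 - m)) hα hβ hγ (fun i hi => ?_)
      (fun _ _ => hy _) (fun i _ => ?_) m le_rfl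
    · have := hx (5 - i) (by omega)
      rwa [Nat.cast_sub (by omega)] at this
    · have h := hrec (5 - (i + 6 : ℕ))
      have e : ∀ j : ℕ, j ≤ 6 → (5 : ℤ) - (i + 6 : ℕ) + j = 5 - (i + (6 - j) : ℕ) :=
        fun j hj => by omega
      have e1 := e 1 (by norm_num); have e2 := e 2 (by norm_num); have e3 := e 3 (by norm_num)
      have e4 := e 4 (by norm_num); have e5 := e 5 (by norm_num); have e6 := e 6 (by norm_num)
      norm_num only [Nat.cast_ofNat, Nat.cast_one, add_zero] at e1 e2 e3 e4 e5 e6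
      rw [e1, e2, e3, e4, e5, e6] at h
      linear_combination h

theorem exists_cosh_parameter : ∃ q : ℝ, 0 < q ∧ q ^ 2 = 1578229 / 1024 :=
  ⟨√(1578229 / 1024), by positivity, Real.sq_sqrt (by norm_num)⟩

/-- If the matrix of products of a two-sided Somos sequence has nonzero connected minors of size `4`,
then its first four columns span all columns. -/
theorem SatisfiesSomosSix.column_mem_span {F : Type*} [Field F] {α β γ : F} {f : ℤ → F}
    (hf : SatisfiesSomosSix α β γ f) (h0 : ∀ n, f n ≠ 0) (hγ : γ ≠ 0) {δ : ℤ}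
    (hδ : δ = 1 ∨ δ = 2)
    (hne : ∀ x y : ℕ, Matrix.det (Matrix.of fun i j : Fin 4 =>
      f ((x + i : ℕ) + (y + j : ℕ) + δ) * f ((x + i : ℕ) - (y + j : ℕ))) ≠ 0)
    {k : ℤ} (hk : 0 ≤ 2 * k + δ) :
    (fun x : ℕ => f (x + k + δ) * f (x - k)) ∈
      Submodule.span F (Set.range fun (a : Fin 4) (x : ℕ) =>
        f (x + (a : ℕ) + δ) * f (x - (a : ℕ))) := by
  have hnat : ∀ y : ℕ, (fun x : ℕ => f (x + y + δ) * f (x - y)) ∈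
      Submodule.span F (Set.range fun (a : Fin 4) (x : ℕ) =>
        f (x + (a : ℕ) + δ) * f (x - (a : ℕ))) := by
    refine column_mem_span_of_connected_minors
      (A := fun x y : ℕ => f (x + y + δ) * f (x - y)) (fun x y => ?_) hne
    rw [← hf.det_products_eq_zero h0 hγ (x + y + δ) (x - y)]
    congr 1
    ext i j
    refine congrArg₂ (fun x y => x * y) (congrArg f ?_) (congrArg f ?_) <;> push_cast <;> ring
  rcases le_or_gt 0 k with h | h
  · obtain ⟨y, rfl⟩ := Int.eq_ofNat_of_zero_le h
    exact hnat y
  -- The columns with `δ = 0` cannot serve as a starting point, since the order 6 relation makes the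
  -- first four dependent. For even `l` the numbering thus starts at `δ = 2`, and the omitted column
  -- of squares, `k = -1`, is recovered from the recurrence by dividing by `γ`.
  · obtain rfl : k = -1 := by omega
    obtain rfl : δ = 2 := by omega
    have e : (fun x : ℕ => f (x + -1 + 2) * f (x - -1)) =
        γ⁻¹ • ((fun x : ℕ => f (x + (2 : ℕ) + 2) * f (x - (2 : ℕ)))
          - α • (fun x : ℕ => f (x + (1 : ℕ) + 2) * f (x - (1 : ℕ)))
          - β • (fun x : ℕ => f (x + (0 : ℕ) + 2) * f (x - (0 : ℕ)))) := by
      ext x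
      have h := hf (x - 2)
      rw [show (x : ℤ) - 2 + 6 = x + 2 + 2 by ring, show (x : ℤ) - 2 + 5 = x + 1 + 2 by ring,
        show (x : ℤ) - 2 + 4 = x + 2 by ring, show (x : ℤ) - 2 + 3 = x + 1 by ring,
        show (x : ℤ) - 2 + 2 = x by ring, show (x : ℤ) - 2 + 1 = x - 1 by ring] at h
      simp only [Pi.smul_apply, Pi.sub_apply, smul_eq_mul, Nat.cast_ofNat, Nat.cast_one,
        Nat.cast_zero, add_zero, sub_zero, sub_neg_eq_add]
      rw [show (x : ℤ) + -1 + 2 = x + 1 by ring, h]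
      field_simp
      ring
    rw [e]
    exact Submodule.smul_mem _ _ (Submodule.sub_mem _ (Submodule.sub_mem _ (hnat 2)
      (Submodule.smul_mem _ _ (hnat 1))) (Submodule.smul_mem _ _ (hnat 0)))

/-- Somos sequences of order `6` have rank at most `4`. -/
theorem det_somos_products_eq_zero {α β γ : ℂ} {s : ℕ → ℂ} {N : ℕ} (hs : ∀ n ≤ N, s n ≠ 0)
    (hrec : ∀ n, n + 6 ≤ N → s (n + 6) * s n =
      α * s (n + 5) * s (n + 1) + β * s (n + 4) * s (n + 2) + γ * s (n + 3) ^ 2)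
    {l : ℕ} (hl : 0 < l) {c : Fin 5 → ℕ} (hc : ∀ j, 2 * c j ≤ l) {x : Fin 5 → ℕ}
    (hx : ∀ i, x i + l ≤ N) :
    Matrix.det (Matrix.of fun i j => s (x i + c j) * s (x i + (l - c j))) = 0 := by
  obtain ⟨q, hq0, hq⟩ := exists_cosh_parameter
  let g : ℤ → ℂ := fun n => (coshSomos q n : ℝ)
  have hg0 : ∀ n, g n ≠ 0 := fun n => Complex.ofReal_ne_zero.2 (coshSomos_pos hq0 n).ne'
  have hg : SatisfiesSomosSix (4497 / 64 : ℂ) (-105369 / 256) (87637 / 256) g := fun n => by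
    have := congrArg (fun t : ℝ => (t : ℂ)) (coshSomos_relation hq n)
    push_cast at this
    exact this
  let α' := lineBetween α (4497 / 64)
  let β' := lineBetween β (-105369 / 256)
  let γ' := lineBetween γ (87637 / 256)
  let x' : ℕ → RatFunc ℂ := fun n => lineBetween (s n) (g n)
  let f := somosTwoSided α' β' γ' x'
  -- At `t = 1` the whole two-sided sequence specializes, which makes every `f n` nonzero; at `t =
  -- 0` only the window `0, …, N` is controlled.
  have h1 : ∀ n, HasValue 1 (f n) (g n) := HasValue.somosTwoSided (hasValue_one_lineBetween _ _)
    (hasValue_one_lineBetween _ _) (hasValue_one_lineBetween _ _)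
    (fun _ _ => hasValue_one_lineBetween _ _) hg0 hg
  have hv0 : ∀ n : ℕ, n ≤ N → HasValue 0 (f n) (s n) := fun n hn => by
    simp only [f, somosTwoSided_natCast]
    exact HasValue.somosForward (hasValue_zero_lineBetween _ _) (hasValue_zero_lineBetween _ _)
      (hasValue_zero_lineBetween _ _) (fun _ _ => hasValue_zero_lineBetween _ _) hs hrec n hn
  have hf0 : ∀ n, f n ≠ 0 := fun n => (h1 n).ne_zero (hg0 n)
  have hf : SatisfiesSomosSix α' β' γ' f := satisfiesSomosSix_somosTwoSided _ _ _ _ hf0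
  have hγ : γ' ≠ 0 := (hasValue_one_lineBetween γ _).ne_zero (by norm_num)
  -- Shifting rows by `h` and putting `k = h - c j` centres the products; `2 * c j ≤ l` becomes `0 ≤
  -- 2 * k + δ`.
  obtain ⟨h, δ, hδ, hlh⟩ : ∃ h δ : ℕ, (δ = 1 ∨ δ = 2) ∧ l = 2 * h + δ :=
    ⟨(l - 1) / 2, l - 2 * ((l - 1) / 2), by omega, by omega⟩
  have hspan : ∀ j : Fin 5, _ := fun j => hf.column_mem_span hf0 hγ (δ := δ)
    (by omega) (fun x y => ?_) (k := (h : ℤ) - c j) (by have := hc j; omega)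
  · have hdet := det_eq_zero_of_columns_mem_span hspan fun i => x i + h
    by_contra hcon
    refine HasValue.ne_zero (a := (0 : ℂ)) (HasValue.det fun i j => ?_) hcon hdet
    have hcj := hc j
    have hxi := hx i
    have e1 : ((x i + h : ℕ) : ℤ) + (h - c j) + δ = (x i + (l - c j) : ℕ) := by omega
    have e2 : ((x i + h : ℕ) : ℤ) - (h - c j) = (x i + c j : ℕ) := by omega
    simp only [Matrix.of_apply]
    rw [e1, e2, mul_comm (f _)]
    exact (hv0 _ (by omega)).mul (hv0 _ (by omega))
  · have hdet := det_coshSomos_ne_zero hq (δ := δ) (by omega) x y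
    refine HasValue.ne_zero (a := (1 : ℂ)) (HasValue.det (N := Matrix.of fun i j : Fin 4 =>
        g ((x + i : ℕ) + (y + j : ℕ) + δ) * g ((x + i : ℕ) - (y + j : ℕ)))
      fun i j => (h1 _).mul (h1 _)) ?_
    have e := RingHom.map_det Complex.ofRealHom (Matrix.of fun i j : Fin 4 =>
      coshSomos q ((x + i : ℕ) + (y + j : ℕ) + δ) * coshSomos q ((x + i : ℕ) - (y + j : ℕ)))
    have e' : Complex.ofRealHom.mapMatrix (Matrix.of fun i j : Fin 4 =>
      coshSomos q ((x + i : ℕ) + (y + j : ℕ) + δ) * coshSomos q ((x + i : ℕ) - (y + j : ℕ))) =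
      Matrix.of fun i j : Fin 4 =>
        g ((x + i : ℕ) + (y + j : ℕ) + δ) * g ((x + i : ℕ) - (y + j : ℕ)) := by
      ext i j
      simp [g]
    rw [e'] at e
    rw [← e]
    exact Complex.ofReal_ne_zero.2 hdet

end Rank

/-! ### Common relations for all decimations -/

theorem IntervalSeq.exists_common_relation {s : IntervalSeq} (hs : s.IsSomos 6)
    (h0 : s.NonzeroTerms) {d n : ℕ} (hd : 0 < d) (hn : 8 ≤ n) :
    ∃ a : Fin 5 → ℂ, a ≠ 0 ∧ ∀ x : ℤ, Set.Icc x (x + d * n) ⊆ s.index →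
      ∑ j : Fin 5, a j * (s.term (x + d * (j : ℕ)) * s.term (x + d * (n - (j : ℕ)))) = 0 := by
  obtain ⟨c, hc0, hc⟩ := hs
  have hdet : ∀ x : Fin 5 → {x : ℤ // Set.Icc x (x + d * n) ⊆ s.index},
      Matrix.det (Matrix.of fun i j : Fin 5 =>
        s.term (x i + d * (j : ℕ)) * s.term (x i + d * (n - (j : ℕ)))) = 0 := by
    intro x
    have hdn : (0 : ℤ) ≤ d * n := by positivity
    -- Five windows lie in one finite stretch of the index interval, from the earliest start to the
    -- latest end. Re-indexing that stretch from 0 reduces to the rank bound.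
    obtain ⟨i₀, hmin⟩ := Finite.exists_min fun i => (x i : ℤ)
    obtain ⟨i₁, hmax⟩ := Finite.exists_max fun i => (x i : ℤ)
    obtain ⟨M, hM⟩ := Int.eq_ofNat_of_zero_le (sub_nonneg.2 (hmin i₁))
    have hb : (x i₀ : ℤ) ∈ s.index := (x i₀).2 (Set.left_mem_Icc.2 (by omega))
    have ht : (x i₁ : ℤ) + d * n ∈ s.index := (x i₁).2 (Set.right_mem_Icc.2 (by omega))
    have hmem : ∀ k : ℕ, k ≤ M + d * n → (x i₀ : ℤ) + k ∈ s.index := fun k hk => by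
      refine s.ordConnected.out hb ht ⟨by omega, ?_⟩
      have : (k : ℤ) ≤ M + d * n := by exact_mod_cast hk
      linarith
    choose y hy using fun i => Int.eq_ofNat_of_zero_le (sub_nonneg.2 (hmin i))
    have key := det_somos_products_eq_zero (α := -c 1 / c 0) (β := -c 2 / c 0) (γ := -c 3 / c 0)
      (s := fun k : ℕ => s.term (x i₀ + k)) (N := M + d * n) (fun k hk => h0 _ (hmem k hk))
      (fun k hk => ?_) (l := d * n) (Nat.mul_pos hd (by omega)) (c := fun j : Fin 5 => d * j)
      (fun j => ?_) (x := y) (fun i => ?_)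
    · rw [← key]
      congr 1
      ext i j
      have hj : (j : ℕ) ≤ n := by have := j.2; omega
      have hyi := hy i
      have hxi : (x i : ℤ) = x i₀ + y i := by linarith
      refine congrArg₂ (fun u v => u * v) (congrArg s.term ?_) (congrArg s.term ?_)
      · rw [hxi]; push_cast; ring
      · rw [hxi, ← Nat.mul_sub]; push_cast [hj]; ring
    · have h := hc (x i₀ + k) (fun z hz => s.ordConnected.out (hmem k (by omega))
        (hmem (k + 6) hk) ⟨hz.1, by have := hz.2; push_cast at this ⊢; linarith⟩)
      have h' : c 0 * (s.term (x i₀ + k) * s.term (x i₀ + k + 6))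
          + c 1 * (s.term (x i₀ + k + 1) * s.term (x i₀ + k + 5))
          + c 2 * (s.term (x i₀ + k + 2) * s.term (x i₀ + k + 4))
          + c 3 * (s.term (x i₀ + k + 3) * s.term (x i₀ + k + 3)) = 0 := by
        have e := Fin.sum_univ_four (fun j : Fin 4 => c j * (s.term (x i₀ + k + (j : ℕ)) *
          s.term (x i₀ + k + (6 : ℕ) - (j : ℕ))))
        rw [show ∑ j : Fin 4, c j * (s.term (x i₀ + k + (j : ℕ)) *
          s.term (x i₀ + k + (6 : ℕ) - (j : ℕ))) = 0 from h] at e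
        rw [e]
        norm_num [add_sub_assoc]
      push_cast
      simp only [← add_assoc]
      field_simp
      linear_combination h'
    · calc 2 * (d * (j : ℕ)) = d * (2 * j) := by ring
        _ ≤ d * n := Nat.mul_le_mul_left d (by have := j.2; omega)
    · have h1 := hy i
      have h2 := hmax i
      have : (y i : ℤ) ≤ M := by linarith
      have : y i ≤ M := by exact_mod_cast this
      omega
  -- The family ranges over windows of all residues at once, so one vector `a` serves every
  -- decimation.
  obtain ⟨a, ha, h⟩ := exists_ne_zero_forall_sum_eq_zero
    (fun (x : {x : ℤ // Set.Icc x (x + d * n) ⊆ s.index}) (j : Fin 5) =>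
      s.term (x + d * (j : ℕ)) * s.term (x + d * (n - (j : ℕ)))) hdet
  exact ⟨a, ha, fun x hx => h ⟨x, hx⟩⟩

theorem IntervalSeq.exists_common_nonstrictClass {s : IntervalSeq} (hs : s.IsSomos 6)
    (h0 : s.NonzeroTerms) {d n : ℕ} (hd : 0 < d) (hn : n = 8 ∨ n = 9) :
    ∃ a : Fin (n / 2 + 1) → ℂ, a ≠ 0 ∧
      ∀ r : ℤ, s.decimation d r ∈ IntervalSeq.nonstrictClass n a := by
  obtain ⟨a, ha, h⟩ := IntervalSeq.exists_common_relation hs h0 hd (n := n) (by omega)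
  have key : ∀ r i : ℤ, Set.Icc i (i + n) ⊆ (s.decimation d r).index →
      ∑ j : Fin 5, a j * ((s.decimation d r).term (i + (j : ℕ)) *
        (s.decimation d r).term (i + n - (j : ℕ))) = 0 := by
    intro r i hi
    rw [← h (r + d * i)]
    · refine Finset.sum_congr rfl fun j _ => ?_
      simp only [IntervalSeq.decimation]
      congr 3 <;> ring
    · have h1 : r + d * i ∈ s.index := hi (Set.left_mem_Icc.2 (by omega))
      have h2 : r + d * (i + n) ∈ s.index := hi (Set.right_mem_Icc.2 (by omega))
      rw [show r + (d : ℤ) * i + d * n = r + d * (i + n) by ring]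
      exact s.ordConnected.out h1 h2
  rcases hn with rfl | rfl
  · exact ⟨a, ha, key⟩
  · exact ⟨a, ha, key⟩

/-! ### Optimality for the unit sequence -/

section Unit

/-- The two-sided unit Somos sequence of order `6`. -/
def unitSomosSix : ℤ → ℚ := somosTwoSided 1 1 1 fun _ => 1

theorem unitSomosSix_pos (n : ℤ) : 0 < unitSomosSix n := by
  have h : ∀ n : ℕ, 0 < somosForward (1 : ℚ) 1 1 (fun _ => 1) n := by
    intro n
    induction n using Nat.strong_induction_on with
    | _ n ih =>
      by_cases h6 : n < 6
      · rw [somosForward_of_lt _ _ _ _ h6]; norm_num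
      · obtain ⟨m, rfl⟩ := Nat.exists_eq_add_of_le' (not_lt.1 h6)
        have h0 := ih m (by omega); have h1 := ih (m + 1) (by omega)
        have h2 := ih (m + 2) (by omega); have h3 := ih (m + 3) (by omega)
        have h4 := ih (m + 4) (by omega); have h5 := ih (m + 5) (by omega)
        rw [somosForward]
        positivity
  unfold unitSomosSix somosTwoSided
  split_ifs <;> exact h _

/-- The constant initial data are unchanged by reversal. -/
theorem unitSomosSix_five_sub (n : ℤ) : unitSomosSix (5 - n) = unitSomosSix n := by
  have h : ∀ n : ℕ, unitSomosSix (5 - n) = unitSomosSix n := fun n => by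
    rw [unitSomosSix, somosTwoSided_five_sub, somosTwoSided_natCast]
  rcases le_or_gt 0 n with hn | hn
  · obtain ⟨m, rfl⟩ := Int.eq_ofNat_of_zero_le hn
    exact h m
  · obtain ⟨m, hm⟩ := Int.eq_ofNat_of_zero_le (show 0 ≤ 5 - n by omega)
    obtain rfl : n = 5 - m := by omega
    rw [h, sub_sub_cancel]

theorem satisfiesSomosSix_unitSomosSix : SatisfiesSomosSix 1 1 1 unitSomosSix :=
  satisfiesSomosSix_somosTwoSided _ _ _ _ fun n => (unitSomosSix_pos n).ne'

theorem unitSomosSix_of_mem {n : ℤ} (h0 : 0 ≤ n) (h6 : n < 6) : unitSomosSix n = 1 := by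
  obtain ⟨m, rfl⟩ := Int.eq_ofNat_of_zero_le h0
  rw [unitSomosSix, somosTwoSided_natCast, somosForward_of_lt _ _ _ _ (by omega)]

theorem unitSomosSix_values :
    unitSomosSix 6 = 3 ∧ unitSomosSix 7 = 5 ∧ unitSomosSix 8 = 9 ∧ unitSomosSix 9 = 23 ∧
    unitSomosSix 10 = 75 ∧ unitSomosSix 11 = 421 ∧ unitSomosSix 12 = 1103 ∧
    unitSomosSix 13 = 5047 := by
  have u0 := unitSomosSix_of_mem (n := 0) (by norm_num) (by norm_num)
  have u1 := unitSomosSix_of_mem (n := 1) (by norm_num) (by norm_num)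
  have u2 := unitSomosSix_of_mem (n := 2) (by norm_num) (by norm_num)
  have u3 := unitSomosSix_of_mem (n := 3) (by norm_num) (by norm_num)
  have u4 := unitSomosSix_of_mem (n := 4) (by norm_num) (by norm_num)
  have u5 := unitSomosSix_of_mem (n := 5) (by norm_num) (by norm_num)
  have u6 := satisfiesSomosSix_unitSomosSix 0
  norm_num [u0, u1, u2, u3, u4, u5] at u6
  have u7 := satisfiesSomosSix_unitSomosSix 1
  norm_num [u1, u2, u3, u4, u5, u6] at u7
  have u8 := satisfiesSomosSix_unitSomosSix 2
  norm_num [u2, u3, u4, u5, u6, u7] at u8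
  have u9 := satisfiesSomosSix_unitSomosSix 3
  norm_num [u3, u4, u5, u6, u7, u8] at u9
  have u10 := satisfiesSomosSix_unitSomosSix 4
  norm_num [u4, u5, u6, u7, u8, u9] at u10
  have u11 := satisfiesSomosSix_unitSomosSix 5
  norm_num [u5, u6, u7, u8, u9, u10] at u11
  have u12 := satisfiesSomosSix_unitSomosSix 6
  norm_num [u6, u7, u8, u9, u10, u11] at u12
  have u13 := satisfiesSomosSix_unitSomosSix 7
  norm_num [u7, u8, u9, u10, u11, u12] at u13
  refine ⟨u6, u7, u8, u9, u10, u11, ?_, ?_⟩ <;> linarith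

/-- The unit Somos sequence as a complex sequence indexed by all integers. -/
noncomputable def unitSomosSixSeq : IntervalSeq where
  index := Set.univ
  ordConnected := Set.ordConnected_univ
  term n := (unitSomosSix n : ℂ)

theorem unitSomosSix_even_decimation {N : ℕ} (hN : N = 6 ∨ N = 7) {b : Fin 4 → ℂ}
    (h : ∀ i : ℤ, ∑ j : Fin 4, b j * ((unitSomosSix (2 * (i + (j : ℕ))) : ℂ) *
      (unitSomosSix (2 * (i + N - (j : ℕ))) : ℂ)) = 0) : b = 0 := by
  have p : ∀ m : ℤ, 0 ≤ m → m < 6 → unitSomosSix m = 1 := fun m => unitSomosSix_of_mem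
  obtain ⟨v6, v7, v8, v9, v10, v11, v12, v13⟩ := unitSomosSix_values
  have u0 := p 0 (by norm_num) (by norm_num)
  have u2 := p 2 (by norm_num) (by norm_num)
  have u4 := p 4 (by norm_num) (by norm_num)
  have w8 := unitSomosSix_five_sub 13
  have w6 := unitSomosSix_five_sub 11
  have w4 := unitSomosSix_five_sub 9
  have w2 := unitSomosSix_five_sub 7
  norm_num [v7, v9, v11, v13] at w2 w4 w6 w8
  rcases hN with rfl | rfl
  -- Four consecutive windows give a nonsingular 4 × 4 system for `b`; the rational weights are the
  -- rows of the inverse matrix. The same happens below for `N = 7`.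
  · have h1 := h (-3); have h2 := h (-2); have h3 := h (-1); have h4 := h 0
    norm_num [Fin.sum_univ_four, u0, u2, u4, v6, v8, v10, v12, w2, w4, w6, w8] at h1 h2 h3 h4
    ext j
    fin_cases j
    · change b 0 = 0
      linear_combination (3 / 1400) * h1 + (-3 / 700) * h2 + (-3 / 700) * h3 + (1 / 1400) * h4
    · change b 1 = 0
      linear_combination (-19 / 700) * h1 + (143 / 700) * h2 + (19 / 350) * h3 + (-9 / 350) * h4
    · change b 2 = 0
      linear_combination (-183 / 700) * h1 + (331 / 700) * h2 + (179 / 175) * h3 + (-24 / 175) * h4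
    · change b 3 = 0
      linear_combination (9 / 40) * h1 + (-33 / 20) * h2 + (-19 / 20) * h3 + (3 / 8) * h4
  · have h1 := h (-4); have h2 := h (-3); have h3 := h (-2); have h4 := h (-1)
    norm_num [Fin.sum_univ_four, u0, u2, u4, v6, v8, v10, v12, w2, w4, w6, w8] at h1 h2 h3 h4
    ext j
    fin_cases j
    · change b 0 = 0
      linear_combination (-3 / 3520) * h1 + (3 / 880) * h2 + (9 / 1760) * h3 + (-1 / 704) * h4
    · change b 1 = 0
      linear_combination (-17 / 3520) * h1 + (17 / 880) * h2 + (139 / 1760) * h3 + (-87 / 3520) * h4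
    · change b 2 = 0
      linear_combination (15 / 16) * h1 + (-13 / 4) * h2 + (-269 / 40) * h3 + (141 / 80) * h4
    · change b 3 = 0
      linear_combination (-9 / 8) * h1 + (3) * h2 + (44 / 5) * h3 + (-69 / 40) * h4

end Unit

theorem unitSomosSix_even_decimation_of_le {n : ℕ} (h1 : 1 ≤ n) (h7 : n ≤ 7)
    {a : Fin (n / 2 + 1) → ℂ}
    (h : ∀ i : ℤ, ∑ j : Fin (n / 2 + 1), a j * ((unitSomosSix (2 * (i + (j : ℕ))) : ℂ) *
      (unitSomosSix (2 * (i + n - (j : ℕ))) : ℂ)) = 0) : a = 0 := by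
  -- Putting `t` zeros before the coefficients lengthens the window by `t` at each end, so the order
  -- rises to 6 or 7 with its parity kept.
  obtain ⟨t, N, hN, hNt, ht⟩ : ∃ t N : ℕ, (N = 6 ∨ N = 7) ∧ N = n + 2 * t ∧ t + (n / 2 + 1) = 4 :=
    ⟨3 - n / 2, n + 2 * (3 - n / 2), by omega, rfl, by omega⟩
  let c : ℕ → ℂ := fun j => if hj : j < n / 2 + 1 then a ⟨j, hj⟩ else 0
  have hc : ∀ j : Fin (n / 2 + 1), c j = a j := fun j => dif_pos j.2
  have hb := unitSomosSix_even_decimation hN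
    (b := fun j : Fin 4 => if t ≤ (j : ℕ) then c (j - t) else 0) (fun i => by
      rw [Fin.sum_univ_eq_sum_range (fun j : ℕ => (if t ≤ j then c (j - t) else 0) *
        ((unitSomosSix (2 * (i + (j : ℕ))) : ℂ) *
          (unitSomosSix (2 * (i + N - (j : ℕ))) : ℂ))) 4, ← ht, Finset.sum_range_add,
        Finset.sum_eq_zero (s := Finset.range t) (fun j hj => by
          rw [if_neg (not_le.2 (Finset.mem_range.1 hj)), zero_mul]), zero_add, ← h (i + t),
        ← Fin.sum_univ_eq_sum_range]
      refine Finset.sum_congr rfl fun j _ => ?_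
      rw [if_pos (Nat.le_add_right _ _), Nat.add_sub_cancel_left, hc, hNt,
        show i + ((t + j : ℕ) : ℤ) = i + t + (j : ℕ) by push_cast; ring,
        show i + ((n + 2 * t : ℕ) : ℤ) - ((t + j : ℕ) : ℤ) = i + t + n - (j : ℕ) by
          push_cast; ring])
  ext j
  have := congrFun hb ⟨t + j, by have := j.2; omega⟩
  simpa [hc] using this

theorem isUnitSomos_unitSomosSixSeq : unitSomosSixSeq.IsUnitSomos 6 := by
  refine ⟨rfl, fun i _ => ?_, fun i h0 h6 => ?_, fun i => ?_⟩
  · exact Rat.cast_ne_zero.2 (unitSomosSix_pos i).ne'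
  · change (unitSomosSix i : ℂ) = 1
    rw [unitSomosSix_of_mem h0 (by exact_mod_cast h6), Rat.cast_one]
  · have h := congrArg (fun x : ℚ => (x : ℂ)) (satisfiesSomosSix_unitSomosSix i)
    rw [show Finset.Icc 1 (6 / 2) = ({1, 2, 3} : Finset ℕ) from rfl]
    rw [Finset.sum_insert (by decide), Finset.sum_insert (by decide), Finset.sum_singleton]
    change (unitSomosSix i : ℂ) * unitSomosSix (i + (6 : ℕ)) =
      (unitSomosSix (i + (1 : ℕ)) : ℂ) * unitSomosSix (i + (6 : ℕ) - (1 : ℕ))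
      + ((unitSomosSix (i + (2 : ℕ)) : ℂ) * unitSomosSix (i + (6 : ℕ) - (2 : ℕ))
      + (unitSomosSix (i + (3 : ℕ)) : ℂ) * unitSomosSix (i + (6 : ℕ) - (3 : ℕ)))
    norm_num [add_sub_assoc] at h ⊢
    linear_combination h

theorem IntervalSeq.IsUnitSomos.isSomos_six {u : IntervalSeq} (hu : u.IsUnitSomos 6) :
    u.IsSomos 6 := by
  refine ⟨(![1, -1, -1, -1] : Fin 4 → ℂ), one_ne_zero, fun i _ => ?_⟩
  have h := hu.2.2.2 i
  rw [show Finset.Icc 1 (6 / 2) = ({1, 2, 3} : Finset ℕ) from rfl, Finset.sum_insert (by decide),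
    Finset.sum_insert (by decide), Finset.sum_singleton] at h
  refine (Fin.sum_univ_four (fun j : Fin 4 => (![1, -1, -1, -1] : Fin 4 → ℂ) j *
    (u.term (i + (j : ℕ)) * u.term (i + (6 : ℕ) - (j : ℕ))))).trans ?_
  change (1 : ℂ) * (u.term (i + (0 : ℕ)) * u.term (i + (6 : ℕ) - (0 : ℕ))) +
    (-1 : ℂ) * (u.term (i + (1 : ℕ)) * u.term (i + (6 : ℕ) - (1 : ℕ))) +
    (-1 : ℂ) * (u.term (i + (2 : ℕ)) * u.term (i + (6 : ℕ) - (2 : ℕ))) +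
    (-1 : ℂ) * (u.term (i + (3 : ℕ)) * u.term (i + (6 : ℕ) - (3 : ℕ))) = 0
  norm_num at h ⊢
  linear_combination h

theorem unitSomosSixSeq_decimation_two_not_isNonstrictSomos (r : ℤ) {n : ℕ} (h1 : 1 ≤ n)
    (h7 : n ≤ 7) : ¬ (unitSomosSixSeq.decimation 2 r).IsNonstrictSomos n := by
  rintro ⟨a, ha, h⟩
  refine ha (unitSomosSix_even_decimation_of_le h1 h7 fun i => ?_)
  have hr : ∀ i : ℤ, ∑ j : Fin (n / 2 + 1), a j * ((unitSomosSix (r + 2 * (i + (j : ℕ))) : ℂ) *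
      (unitSomosSix (r + 2 * (i + n - (j : ℕ))) : ℂ)) = 0 :=
    fun i => h i fun _ _ => Set.mem_univ _
  obtain ⟨ρ, hρ⟩ := Int.even_or_odd' r
  rcases hρ with rfl | rfl
  · rw [← hr (i - ρ)]
    refine Finset.sum_congr rfl fun j _ => ?_
    congr 4 <;> ring
  -- The reflection `m ↦ 5 - m` exchanges odd and even indices; this starting index makes the
  -- reflected window the even one at `i`, with the two factors of each product swapped.
  · rw [← hr (2 - ρ - i - n)]
    refine Finset.sum_congr rfl fun j _ => ?_
    rw [mul_comm (unitSomosSix (2 * (i + (j : ℕ))) : ℂ), ← unitSomosSix_five_sub (2 * (i + (j : ℕ))),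
      ← unitSomosSix_five_sub (2 * (i + n - (j : ℕ)))]
    congr 4 <;> ring

theorem proposition4 :
    (∀ s : IntervalSeq, s.IsSomos 6 → s.NonzeroTerms →
      (∀ d : ℕ, 0 < d → ∀ r : ℤ,
        (s.decimation d r).IsNonstrictSomos 8 ∧ (s.decimation d r).IsNonstrictSomos 9) ∧
      (∀ d : ℕ, 0 < d → ∀ n : ℕ, n = 8 ∨ n = 9 →
        ∃ a : Fin (n / 2 + 1) → ℂ, a ≠ 0 ∧
          ∀ r : ℤ, s.decimation d r ∈ IntervalSeq.nonstrictClass n a)) ∧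
    (∃ u : IntervalSeq, u.IsUnitSomos 6 ∧ u.IsSomos 6 ∧ u.NonzeroTerms ∧
      ∀ r : ℤ, ∀ n : ℕ, 1 ≤ n → n ≤ 7 → ¬ (u.decimation 2 r).IsNonstrictSomos n) := by
  refine ⟨fun s hs h0 => ⟨fun d hd r => ⟨?_, ?_⟩, fun d hd n hn =>
    IntervalSeq.exists_common_nonstrictClass hs h0 hd hn⟩, unitSomosSixSeq,
    isUnitSomos_unitSomosSixSeq, isUnitSomos_unitSomosSixSeq.isSomos_six,
    isUnitSomos_unitSomosSixSeq.2.1, fun r n h1 h7 =>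
    unitSomosSixSeq_decimation_two_not_isNonstrictSomos r h1 h7⟩
  · obtain ⟨a, ha, h⟩ := IntervalSeq.exists_common_nonstrictClass hs h0 hd (.inl rfl)
    exact ⟨a, ha, h r⟩
  · obtain ⟨a, ha, h⟩ := IntervalSeq.exists_common_nonstrictClass hs h0 hd (.inr rfl)
    exact ⟨a, ha, h r⟩
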